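/- Fix integers $k,d\ge 1$ and a real number $\varepsilon$. A $k\times n$ matrix $S$ is an $\varepsilon$-subspace embedding for an $n\times d$ matrix $A$ if $(1-\varepsilon)\|Az\|_2^2\le\|SAz\|_2^2\le(1+\varepsilon)\|Az\|_2^2$ for all $z\in\mathbb{R}^d$. Consider a sequence of real data matrices $A_{(n)}$ of size $n\times d$ and rank $d$, where $n$ runs through a sequence of positive integers tending to infinity. Let $A_{(n)}=U_{(n)}D_{(n)}V_{(n)}^{\mathsf T}$ be singular value decompositions, where $U_{(n)}$ is $n\times d$ with orthonormal columns, and let $u_{(n)i}^{\mathsf T}$ be the $i$th row of $U_{(n)}$. Assume that the maximum leverage score tends to zero: $\lim_{n\to\infty}\max_{1\le i\le n}\|u_{(n)i}\|_2^2=0$. Let $W\sim\mathrm{Wishart}(k,I_d/k)$, that is, $W=\sum_{r=1}^k x_rx_r^{\mathsf T}$ with $x_1,\dots,x_k$ independent $N(0,I_d/k)$ vectors, and let $\sigma_{\max}$ denote the largest singular value. (Hadamard sketch.) For each $n$ let $H_{(n)}$ be a Hadamard matrix of some order $m=m(n)\ge n$, let $\bar A_{(n)}$ be the $m\times d$ matrix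 obtained by appending $m-n$ zero rows to $A_{(n)}$ (so $\bar A_{(n)}=A_{(n)}$ if $m=n$), and let $S_{(n)}=\Phi H_{(n)}D/\sqrt{k}$, where $\Phi$ is the random $k\times m$ matrix that selects $k$ rows independently and uniformly with replacement, and $D$ is an independent $m\times m$ diagonal matrix with independent Rademacher diagonal entries. Then $$\lim_{n\to\infty}\Pr\bigl(S_{(n)}\text{ is an }\varepsilon\text{-subspace embedding for }\bar A_{(n)}\bigr)=\Pr\bigl(\sigma_{\max}(I_d-W)\le\varepsilon\bigr).$$ (Clarkson–Woodruff sketch.) Let $S_{(n)}=\Gamma D$, where $\Gamma$ is the random $k\times n$ matrix each of whose columns, independently, has a single entry $1$ in a uniformly chosen row and zeros elsewhere, and $D$ is an independent $n\times n$ diagonal matrix with independent Rademacher diagonal entries. Then $$\lim_{n\to\infty}\Pr\bigl(S_{(n)}\text{ is an }\varepsilon\text{-subspace embedding for }A_{(n)}\bigr)=\Pr\bigl(\sigma_{\max}(I_d-W)\le\varepsilon\bigr).$$ In both cases the limit is the Gaussian-sketch value: if $S$ is a $k\times n$ matrix with independent $N(0,1/k)$ entries, then for every $n$ in the sequence $\Pr(S\text{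 is an }\varepsilon\text{-subspace embedding for }A_{(n)})=\Pr(\sigma_{\max}(I_d-W)\le\varepsilon)$. -/

import Mathlib

open MeasureTheory ProbabilityTheory Filter Topology

/-- The product `σ`-algebra on matrices. -/
instance Matrix.instMeasurableSpacePi {m n α : Type*} [MeasurableSpace α] :
    MeasurableSpace (Matrix m n α) :=
  inferInstanceAs (MeasurableSpace (m → n → α))

namespace Sketching

/-- `S` is an `ε`-subspace embedding for `A`: for all `z`,
`(1 - ε) ‖A z‖² ≤ ‖S A z‖² ≤ (1 + ε) ‖A z‖²` (Euclidean norms). -/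
def IsSubspaceEmbedding {k n d : ℕ} (ε : ℝ) (S : Matrix (Fin k) (Fin n) ℝ)
    (A : Matrix (Fin n) (Fin d) ℝ) : Prop :=
  ∀ z : Fin d → ℝ,
    (1 - ε) * ‖WithLp.toLp 2 (A.mulVec z)‖ ^ 2 ≤ ‖WithLp.toLp 2 ((S * A).mulVec z)‖ ^ 2 ∧
      ‖WithLp.toLp 2 ((S * A).mulVec z)‖ ^ 2 ≤ (1 + ε) * ‖WithLp.toLp 2 (A.mulVec z)‖ ^ 2

/-- `A = U diag(s) Vᵀ` is a (thin) singular value decomposition of the `n × d` matrix `A`: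
`U` is `n × d` with orthonormal columns, `V` is `d × d` orthogonal, `s ≥ 0`. -/
structure IsSVD {n d : ℕ} (A U : Matrix (Fin n) (Fin d) ℝ) (s : Fin d → ℝ)
    (V : Matrix (Fin d) (Fin d) ℝ) : Prop where
  left_orthonormal : U.transpose * U = 1
  right_orthonormal : V.transpose * V = 1
  nonneg : ∀ i, 0 ≤ s i
  eq_mul : A = U * Matrix.diagonal s * V.transpose

/-- The largest leverage score `max_i ‖u_i‖²`, where `u_i` are the rows of the matrix `U` of left
singular vectors. -/
noncomputable def maxLeverage {n d : ℕ} (U : Matrix (Fin n) (Fin d) ℝ) : ℝ :=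
  ⨆ i : Fin n, ‖WithLp.toLp 2 (U i)‖ ^ 2

/-- The largest singular value of a square matrix. -/
noncomputable def sigmaMax {d : ℕ} (M : Matrix (Fin d) (Fin d) ℝ) : ℝ :=
  (Matrix.toEuclideanLin M).singularValues 0

/-- The Rademacher distribution: `±1` with probability `1/2` each. -/
noncomputable def rademacher : Measure ℝ :=
  (2⁻¹ : ENNReal) • Measure.dirac 1 + (2⁻¹ : ENNReal) • Measure.dirac (-1)

/-- The `k × m` matrix that selects the rows with the indices `r 0, …, r (k - 1)`. -/
def rowSelection {k m : ℕ} (r : Fin k → Fin m) : Matrix (Fin k) (Fin m) ℝ :=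
  Matrix.of fun a i => if r a = i then 1 else 0

/-- The `k × n` matrix with exactly one nonzero entry `1` in every column, in column `i` at
row `c i`. -/
def columnHash {k n : ℕ} (c : Fin n → Fin k) : Matrix (Fin k) (Fin n) ℝ :=
  Matrix.of fun a i => if c i = a then 1 else 0

/-- The law of the Hadamard sketch `S = Φ H D / √k`, for a fixed Hadamard matrix `H` of order `m`:
`Φ` selects `k` rows independently and uniformly with replacement, `D` is diagonal with independent
Rademacher entries, and `Φ`, `D` are independent. -/
noncomputable def hadamardSketch (k : ℕ) {m : ℕ} (H : Matrix (Fin m) (Fin m) ℝ) :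
    Measure (Matrix (Fin k) (Fin m) ℝ) :=
  ((Measure.pi fun _ : Fin k => uniformOn (Set.univ : Set (Fin m))).prod
      (Measure.pi fun _ : Fin m => rademacher)).map
    fun p => (√(k : ℝ))⁻¹ • (rowSelection p.1 * H * Matrix.diagonal p.2)

/-- The law of the Clarkson–Woodruff sketch `S = Γ D`: each column of `Γ`, independently, has one
entry `1` in a uniformly chosen row and zeros elsewhere, `D` is diagonal with independent Rademacher
entries, and `Γ`, `D` are independent. -/
noncomputable def clarksonWoodruffSketch (k n : ℕ) : Measure (Matrix (Fin k) (Fin n) ℝ) :=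
  ((Measure.pi fun _ : Fin n => uniformOn (Set.univ : Set (Fin k))).prod
      (Measure.pi fun _ : Fin n => rademacher)).map
    fun p => columnHash p.1 * Matrix.diagonal p.2

/-- The law of the Gaussian sketch: a `k × n` matrix with independent `N(0, 1/k)` entries. -/
noncomputable def gaussianSketch (k n : ℕ) : Measure (Matrix (Fin k) (Fin n) ℝ) :=
  (Measure.pi fun _ : Fin k => Measure.pi fun _ : Fin n =>
    gaussianReal 0 (1 / (k : NNReal))).map fun x => Matrix.of x

/-- The Wishart distribution with `k` degrees of freedom and scale matrix `C`: the law of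
`∑ r, x_r x_rᵀ` with `x_1, …, x_k` independent `N(0, C)` vectors. -/
noncomputable def wishart (k : ℕ) {d : ℕ} (C : Matrix (Fin d) (Fin d) ℝ) :
    Measure (Matrix (Fin d) (Fin d) ℝ) :=
  (Measure.pi fun _ : Fin k => multivariateGaussian (0 : EuclideanSpace ℝ (Fin d)) C).map
    fun x => ∑ r, Matrix.vecMulVec (x r).ofLp (x r).ofLp

/-- The matrix `A` with zero rows appended (when `n ≤ m`), so that it has `m` rows. -/
def zeroPad {n d : ℕ} (m : ℕ) (A : Matrix (Fin n) (Fin d) ℝ) : Matrix (Fin m) (Fin d) ℝ :=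
  Matrix.of fun i l => if h : (i : ℕ) < n then A ⟨i, h⟩ l else 0

end Sketching

/-!
Write `A = U C` with `C = diag(s) Vᵀ` invertible and `UᵀU = 1`. Then `S` is an `ε`-subspace embedding
for `A` exactly when the `k × d` matrix `X = S U` satisfies `(1 - ε) ‖w‖² ≤ ‖X w‖² ≤ (1 + ε) ‖w‖²` for
all `w` (`isSubspaceEmbedding_mul_iff`), and for `W = XᵀX` this says `σ_max(I - W) ≤ ε`
(`sigmaMax_one_sub_gram_le_iff`). So everything reduces to the law of `X`, and the limiting
probability is that of this event, `nearIsometrySet`, when `X` has independent `N(0, I_d / k)` rows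
(`gaussianRows`). A Gaussian sketch gives this law exactly (`gaussianSketch_map_toRows_mul`). For the
other two sketches `X` converges in distribution to it, and two things remain.

*The boundary of the event is negligible.* A boundary point `X` has `1 + ε` or `1 - ε` as an
eigenvalue of `XᵀX`. For `c ≠ 0` the set of `X` such that `c` is an eigenvalue of `XᵀX` meets every
line through the origin in a finite set, so it is Lebesgue null (`volume_gramEigenvalueSet`). The value
`c = 0` needs care: `XᵀX` is singular whenever `k < d`. But `1 - ε = 0` makes the lower bound vacuous,
and `1 + ε = 0` makes the event empty.

*Convergence in distribution*, by Lévy's theorem. Averaging over the signs turns the characteristic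
function at `t` into an average of products of cosines (`charFun_map_toRows_mul_diagonal`), and
`cos x = exp(-x²/2) + O(x⁴)`. With `u_i` the rows of `U`, the arguments of the cosines are controlled
by `‖u_i‖ ‖t‖`, so the total error is at most the largest leverage score times a constant depending on
`t`, `k` and `d`. For the Clarkson–Woodruff sketch the hash values are independent over the columns, the
average factorizes, and the exponents add up to `-‖t‖² / (2k)` exactly. For the Hadamard sketch the
covariance given the sampled rows is random; its diagonal blocks are exact, and the off-diagonal ones
have second moments `∑ i, ⟨u_i, t_a⟩² ⟨u_i, t_b⟩²`, which tend to zero, because the columns of a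
Hadamard matrix are orthogonal (`integral_sq_sum_hadamard`).
-/

namespace Sketching

open scoped RealInnerProductSpace

/-! ### The embedding condition on the sketched singular vectors -/

/-- Real `k × d` matrices viewed as `k`-tuples of rows in `ℝ^d`, with the Euclidean (Frobenius)
norm. -/
abbrev RowSpace (k d : ℕ) : Type := PiLp 2 fun _ : Fin k => EuclideanSpace ℝ (Fin d)

/-- The rows of a matrix, as a point of the Euclidean space `RowSpace k d`. -/
noncomputable def toRows {k d : ℕ} (X : Matrix (Fin k) (Fin d) ℝ) : RowSpace k d :=
  WithLp.toLp 2 fun a => WithLp.toLp 2 (X a)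

/-- The set of matrices `X` with `(1 - ε) ‖w‖² ≤ ‖X w‖² ≤ (1 + ε) ‖w‖²` for all `w`. -/
def nearIsometrySet (k d : ℕ) (ε : ℝ) : Set (RowSpace k d) :=
  {x | ∀ w : EuclideanSpace ℝ (Fin d),
    (1 - ε) * ‖w‖ ^ 2 ≤ ∑ a, ⟪x a, w⟫ ^ 2 ∧ ∑ a, ⟪x a, w⟫ ^ 2 ≤ (1 + ε) * ‖w‖ ^ 2}

/-- The operator `XᵀX = ∑ a, x_a x_aᵀ`, where `x_a` are the rows of `X`. -/
noncomputable def gramOp {k d : ℕ} (x : RowSpace k d) :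
    EuclideanSpace ℝ (Fin d) →L[ℝ] EuclideanSpace ℝ (Fin d) :=
  ∑ a, (innerSL ℝ (x a)).smulRight (x a)

variable {k d : ℕ}

@[simp] lemma toRows_apply (X : Matrix (Fin k) (Fin d) ℝ) (a : Fin k) :
    toRows X a = WithLp.toLp 2 (X a) := rfl

lemma gramOp_apply (x : RowSpace k d) (w : EuclideanSpace ℝ (Fin d)) :
    gramOp x w = ∑ a, ⟪x a, w⟫ • x a := by
  simp [gramOp]

lemma inner_gramOp_self (x : RowSpace k d) (w : EuclideanSpace ℝ (Fin d)) :
    ⟪gramOp x w, w⟫ = ∑ a, ⟪x a, w⟫ ^ 2 := by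
  simp [gramOp_apply, sum_inner, real_inner_smul_left, sq]

lemma gramOp_isSymmetric (x : RowSpace k d) : (gramOp x).toLinearMap.IsSymmetric := by
  intro v w
  simp only [ContinuousLinearMap.coe_coe, gramOp_apply, sum_inner, inner_sum,
    real_inner_smul_left, real_inner_smul_right]
  refine Finset.sum_congr rfl fun a _ => ?_
  rw [real_inner_comm v (x a)]
  ring

lemma gramOp_smul (t : ℝ) (x : RowSpace k d) : gramOp (t • x) = t ^ 2 • gramOp x := by
  ext1 w
  simp only [gramOp_apply, _root_.smul_apply, Finset.smul_sum]
  refine Finset.sum_congr rfl fun a _ => ?_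
  simp only [PiLp.smul_apply, real_inner_smul_left, smul_smul]
  ring_nf

lemma continuous_gramOp_apply :
    Continuous fun p : EuclideanSpace ℝ (Fin d) × RowSpace k d => gramOp p.2 p.1 := by
  simp only [gramOp_apply]
  fun_prop

lemma norm_sq_mulVec_eq_sum_inner (X : Matrix (Fin k) (Fin d) ℝ) (w : Fin d → ℝ) :
    ‖WithLp.toLp 2 (X.mulVec w)‖ ^ 2 = ∑ a, ⟪toRows X a, WithLp.toLp 2 w⟫ ^ 2 := by
  rw [EuclideanSpace.real_norm_sq_eq]
  refine Finset.sum_congr rfl fun a _ => ?_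
  simp only [Matrix.mulVec, toRows_apply, EuclideanSpace.inner_toLp_toLp, star_trivial]
  rw [dotProduct_comm]

/-- Matrices with orthonormal columns preserve the Euclidean norm. -/
lemma norm_mulVec_of_transpose_mul_self {n : ℕ} {U : Matrix (Fin n) (Fin d) ℝ}
    (hU : U.transpose * U = 1) (w : Fin d → ℝ) :
    ‖WithLp.toLp 2 (U.mulVec w)‖ ^ 2 = ‖WithLp.toLp 2 w‖ ^ 2 := by
  have key : U.mulVec w ⬝ᵥ U.mulVec w = w ⬝ᵥ w := by
    rw [Matrix.dotProduct_mulVec, Matrix.vecMul_mulVec, hU, Matrix.vecMul_one]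
  rw [EuclideanSpace.real_norm_sq_eq, EuclideanSpace.real_norm_sq_eq]
  simpa only [dotProduct, ← sq] using key

/-- Whether `S` embeds the column space of `U C`, with `C` invertible and `U` having orthonormal
columns, depends only on `S U`. -/
lemma isSubspaceEmbedding_mul_iff {n : ℕ} {U : Matrix (Fin n) (Fin d) ℝ}
    (hU : U.transpose * U = 1) {C : Matrix (Fin d) (Fin d) ℝ} (hC : IsUnit C) (ε : ℝ)
    (S : Matrix (Fin k) (Fin n) ℝ) :
    IsSubspaceEmbedding ε S (U * C) ↔ toRows (S * U) ∈ nearIsometrySet k d ε := by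
  have hsurj : Function.Surjective C.mulVec := Matrix.mulVec_surjective_iff_isUnit.2 hC
  constructor
  · intro h w
    obtain ⟨z, hz⟩ := hsurj w.ofLp
    have := h z
    simp only [← Matrix.mul_assoc, ← Matrix.mulVec_mulVec, hz] at this
    simp only [Matrix.mulVec_mulVec] at this
    rwa [norm_mulVec_of_transpose_mul_self hU, norm_sq_mulVec_eq_sum_inner] at this
  · intro h z
    have := h (WithLp.toLp 2 (C.mulVec z))
    rw [← norm_sq_mulVec_eq_sum_inner, ← norm_mulVec_of_transpose_mul_self hU] at this
    simpa only [← Matrix.mul_assoc, Matrix.mulVec_mulVec] using this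

lemma isUnit_diagonal_mul_transpose_of_isSVD {n : ℕ} {A U : Matrix (Fin n) (Fin d) ℝ}
    {s : Fin d → ℝ} {V : Matrix (Fin d) (Fin d) ℝ} (h : IsSVD A U s V) (hA : A.rank = d) :
    IsUnit (Matrix.diagonal s * V.transpose) := by
  set C := Matrix.diagonal s * V.transpose with hC
  have h1 : d ≤ C.rank := by
    have := h.eq_mul
    rw [Matrix.mul_assoc] at this
    calc d = A.rank := hA.symm
      _ = (U * C).rank := by rw [this]
      _ ≤ C.rank := Matrix.rank_mul_le_right _ _
  have h2 : Module.finrank ℝ C.mulVecLin.range = Module.finrank ℝ (Fin d → ℝ) :=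
    le_antisymm (Submodule.finrank_le _) (by rwa [Module.finrank_fin_fun])
  rw [← Matrix.mulVec_surjective_iff_isUnit]
  exact LinearMap.range_eq_top.1 (Submodule.eq_top_of_finrank_eq h2)

lemma zeroPad_mul {n : ℕ} (m : ℕ) (U : Matrix (Fin n) (Fin d) ℝ) (C : Matrix (Fin d) (Fin d) ℝ) :
    zeroPad m (U * C) = zeroPad m U * C := by
  ext i j
  simp only [zeroPad, Matrix.of_apply, Matrix.mul_apply]
  split_ifs <;> simp

/-- Sums over the rows of a zero-padded matrix only see the original rows. -/
lemma sum_zeroPad {n m : ℕ} (hnm : n ≤ m) (U : Matrix (Fin n) (Fin d) ℝ)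
    (f : (Fin d → ℝ) → ℝ) (hf : f 0 = 0) :
    ∑ i, f (zeroPad m U i) = ∑ i, f (U i) := by
  have hinj : Function.Injective (Fin.castLE hnm) := Fin.castLE_injective hnm
  symm
  refine Finset.sum_of_injOn (Fin.castLE hnm) hinj.injOn (by simp) ?_ ?_
  · intro i _ hi
    have : ¬ (i : ℕ) < n := fun h => hi ⟨⟨i, h⟩, by simp, rfl⟩
    rw [← hf]
    congr 1
    ext l
    simp [zeroPad, this]
  · intro i _
    congr 1
    ext l
    simp [zeroPad]

lemma zeroPad_transpose_mul_self {n m : ℕ} (hnm : n ≤ m) {U : Matrix (Fin n) (Fin d) ℝ}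
    (hU : U.transpose * U = 1) : (zeroPad m U).transpose * zeroPad m U = 1 := by
  rw [← hU]
  ext a b
  simp only [Matrix.mul_apply, Matrix.transpose_apply]
  exact sum_zeroPad hnm U (fun v => v a * v b) (by simp)

/-! ### The largest singular value -/

lemma sigmaMax_le_iff_norm_le (hd : 1 ≤ d) (M : Matrix (Fin d) (Fin d) ℝ) (ε : ℝ) :
    sigmaMax M ≤ ε ↔ ‖Matrix.toEuclideanCLM (𝕜 := ℝ) M‖ ≤ ε := by
  set T := Matrix.toEuclideanLin M with hT
  have hTM : ∀ w, Matrix.toEuclideanCLM (𝕜 := ℝ) M w = T w := fun w => rfl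
  have hfin : Module.finrank ℝ (EuclideanSpace ℝ (Fin d)) = d := by simp
  have hnorm : ∀ w, ⟪(T.adjoint ∘ₗ T) w, w⟫ = ‖T w‖ ^ 2 := fun w => by
    simp [LinearMap.adjoint_inner_left]
  suffices h : sigmaMax M = ‖Matrix.toEuclideanCLM (𝕜 := ℝ) M‖ by rw [h]
  have h0 : 0 ≤ sigmaMax M := T.singularValues_nonneg 0
  refine le_antisymm ?_ (ContinuousLinearMap.opNorm_le_bound _ h0 fun w => ?_)
  · obtain ⟨v, hv⟩ := (T.hasEigenvalue_adjoint_comp_self_sq_singularValues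
      (n := 0) (by omega)).exists_hasEigenvector
    have h1 : (T.singularValues 0 * ‖v‖) ^ 2 = ‖T v‖ ^ 2 := by
      rw [← hnorm, hv.apply_eq_smul, real_inner_smul_left, real_inner_self_eq_norm_sq, mul_pow]
      rfl
    have h2 : T.singularValues 0 * ‖v‖ = ‖T v‖ :=
      (pow_left_inj₀ (mul_nonneg h0 (norm_nonneg _)) (norm_nonneg _) two_ne_zero).1 h1
    have h3 := (Matrix.toEuclideanCLM (𝕜 := ℝ) M).le_opNorm v
    rw [hTM, ← h2] at h3
    exact le_of_mul_le_mul_right h3 (norm_pos_iff.2 hv.2)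
  · rw [hTM]
    refine (pow_le_pow_iff_left₀ (norm_nonneg _) (by positivity) two_ne_zero).1 ?_
    have hS := T.isSymmetric_adjoint_comp_self
    set b := hS.eigenvectorBasis hfin
    rw [← hnorm, ← b.sum_inner_mul_inner, mul_pow, ← b.sum_sq_inner_right w, Finset.mul_sum]
    refine Finset.sum_le_sum fun i _ => ?_
    rw [real_inner_comm, ← b.repr_apply_apply,
      LinearMap.IsSymmetric.eigenvectorBasis_apply_self_apply, b.repr_apply_apply,
      ← T.sq_singularValues_fin hfin]
    simp only [RCLike.ofReal_real_eq_id, id_eq]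
    rw [mul_assoc, ← sq]
    refine mul_le_mul_of_nonneg_right ?_ (sq_nonneg _)
    exact pow_le_pow_left₀ (T.singularValues_nonneg _) (T.singularValues_antitone (Nat.zero_le _)) 2

lemma isClosed_sigmaMax_one_sub_le (hd : 1 ≤ d) (ε : ℝ) :
    IsClosed {W : Matrix (Fin d) (Fin d) ℝ | sigmaMax (1 - W) ≤ ε} := by
  simp_rw [sigmaMax_le_iff_norm_le hd]
  have h : Continuous fun W : Matrix (Fin d) (Fin d) ℝ =>
      Matrix.toEuclideanCLM (𝕜 := ℝ) (1 - W) := by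
    have : Continuous (Matrix.toEuclideanCLM (𝕜 := ℝ) (n := Fin d)) :=
      LinearMap.continuous_of_finiteDimensional
        (Matrix.toEuclideanCLM (𝕜 := ℝ) (n := Fin d)).toAlgEquiv.toLinearMap
    exact this.comp (continuous_const.sub continuous_id)
  exact isClosed_le h.norm continuous_const

lemma toEuclideanCLM_sum_vecMulVec (x : RowSpace k d) :
    Matrix.toEuclideanCLM (𝕜 := ℝ) (1 - ∑ r, Matrix.vecMulVec (x r).ofLp (x r).ofLp) =
      1 - gramOp x := by
  rw [map_sub, map_one, map_sum]
  congr 1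
  ext1 w
  simp only [gramOp_apply, _root_.sum_apply]
  refine Finset.sum_congr rfl fun a _ => ?_
  ext i
  simp [Matrix.vecMulVec_mulVec, PiLp.inner_apply, dotProduct, mul_comm]

/-- For `W = XᵀX`, the condition `σ_max(I - W) ≤ ε` says that `X` is nearly isometric. -/
lemma sigmaMax_one_sub_gram_le_iff (hd : 1 ≤ d) (x : RowSpace k d) (ε : ℝ) :
    sigmaMax (1 - ∑ r, Matrix.vecMulVec (x r).ofLp (x r).ofLp) ≤ ε ↔
      x ∈ nearIsometrySet k d ε := by
  rw [sigmaMax_le_iff_norm_le hd, toEuclideanCLM_sum_vecMulVec]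
  have hinner : ∀ w, ⟪(1 - gramOp x) w, w⟫ = ‖w‖ ^ 2 - ∑ a, ⟪x a, w⟫ ^ 2 := fun w => by
    simp [inner_sub_left, inner_gramOp_self]
  have hsymm : (1 - gramOp x).toLinearMap.IsSymmetric := by
    intro v w
    have := gramOp_isSymmetric x v w
    simp only [ContinuousLinearMap.coe_coe] at this
    simp [inner_sub_left, inner_sub_right, this]
  constructor
  · intro h w
    have h1 : |⟪(1 - gramOp x) w, w⟫| ≤ ε * ‖w‖ ^ 2 :=
      (abs_real_inner_le_norm _ _).trans <| by
        have := (1 - gramOp x).le_of_opNorm_le h w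
        nlinarith [norm_nonneg w]
    rw [hinner, abs_le] at h1
    constructor <;> linarith [h1.1, h1.2]
  · intro h
    have : Nonempty (EuclideanSpace ℝ (Fin d)) := ⟨0⟩
    have hε : 0 ≤ ε := by
      have h1 := h (EuclideanSpace.single ⟨0, hd⟩ 1)
      simp only [PiLp.norm_single, norm_one] at h1
      linarith [h1.1, h1.2]
    rw [ContinuousLinearMap.norm_eq_iSup_rayleighQuotient _ hsymm]
    refine ciSup_le fun w => ?_
    rw [ContinuousLinearMap.rayleighQuotient, ContinuousLinearMap.reApplyInnerSelf_apply, abs_div,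
      abs_sq]
    refine div_le_of_le_mul₀ (sq_nonneg _) hε ?_
    simp only [RCLike.re_to_real]
    rw [hinner, abs_le]
    constructor <;> linarith [(h w).1, (h w).2]

/-! ### The boundary of the embedding condition is negligible -/

/-- The matrices `X` such that `c` is an eigenvalue of `XᵀX`. -/
def gramEigenvalueSet (k d : ℕ) (c : ℝ) : Set (RowSpace k d) :=
  {x | ∃ w ∈ Metric.sphere (0 : EuclideanSpace ℝ (Fin d)) 1, gramOp x w = c • w}

/-- A closed condition remains closed after existential quantification over the unit sphere. -/
lemma isClosed_exists_mem_sphere {p : EuclideanSpace ℝ (Fin d) → RowSpace k d → Prop}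
    (hp : IsClosed {q : EuclideanSpace ℝ (Fin d) × RowSpace k d | p q.1 q.2}) :
    IsClosed {x | ∃ w ∈ Metric.sphere (0 : EuclideanSpace ℝ (Fin d)) 1, p w x} := by
  have hK : CompactSpace (Metric.sphere (0 : EuclideanSpace ℝ (Fin d)) 1) :=
    isCompact_iff_compactSpace.1 (isCompact_sphere _ _)
  have hc : IsClosed {q : Metric.sphere (0 : EuclideanSpace ℝ (Fin d)) 1 × RowSpace k d |
      p q.1 q.2} :=
    hp.preimage (f := fun q : Metric.sphere (0 : EuclideanSpace ℝ (Fin d)) 1 × RowSpace k d =>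
      ((q.1 : EuclideanSpace ℝ (Fin d)), q.2)) (by fun_prop)
  convert isClosedMap_snd_of_compactSpace _ hc using 1
  ext x
  simp

lemma isClosed_gramEigenvalueSet (c : ℝ) : IsClosed (gramEigenvalueSet k d c) :=
  isClosed_exists_mem_sphere
    (isClosed_eq continuous_gramOp_apply (continuous_fst.const_smul c))

lemma isClosed_nearIsometrySet (ε : ℝ) : IsClosed (nearIsometrySet k d ε) := by
  simp only [nearIsometrySet, Set.ofPred_forall, Set.ofPred_and]
  refine isClosed_iInter fun w => IsClosed.inter ?_ ?_
  · exact isClosed_le (by fun_prop) (by fun_prop)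
  · exact isClosed_le (by fun_prop) (by fun_prop)

/-- A line through the origin meets `gramEigenvalueSet k d c` in finitely many points: `t • x`
belongs to it only if `c / t ^ 2` is an eigenvalue of `gramOp x`. -/
lemma finite_setOf_smul_mem_gramEigenvalueSet {c : ℝ} (hc : c ≠ 0) (x : RowSpace k d) :
    {t : ℝ | t • x ∈ gramEigenvalueSet k d c}.Finite := by
  have hfin := Module.End.finite_hasEigenvalue (gramOp x).toLinearMap
  have hpre : (⋃ μ ∈ {μ | Module.End.HasEigenvalue (gramOp x).toLinearMap μ},
      {t : ℝ | t ^ 2 = c / μ}).Finite := by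
    refine hfin.biUnion fun μ _ => ?_
    refine (Set.toFinite {√(c / μ), -√(c / μ)}).subset fun t ht => ?_
    have ht' : t ^ 2 = c / μ := ht
    have : t ^ 2 = √(c / μ) ^ 2 := by rw [Real.sq_sqrt (ht' ▸ sq_nonneg t), ht']
    simpa using sq_eq_sq_iff_eq_or_eq_neg.1 this
  refine hpre.subset fun t ht => ?_
  obtain ⟨w, hw, hwc⟩ := ht
  have hw0 : w ≠ 0 := by
    rintro rfl
    simp at hw
  have ht0 : t ≠ 0 := by
    rintro rfl
    rw [gramOp_smul] at hwc
    have h0 : c • w = 0 := by rw [← hwc]; simp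
    exact (smul_ne_zero hc hw0) h0
  have hμ : gramOp x w = (c / t ^ 2) • w := by
    rw [gramOp_smul] at hwc
    have h2 : t ^ 2 • gramOp x w = c • w := hwc
    rw [div_eq_inv_mul, mul_smul, ← h2, inv_smul_smul₀ (pow_ne_zero 2 ht0)]
  refine Set.mem_biUnion (x := c / t ^ 2)
    (Module.End.hasEigenvalue_of_hasEigenvector (x := w) ?_) ?_
  · exact Module.End.hasEigenvector_iff.2 ⟨Module.End.mem_eigenspace_iff.2 hμ, hw0⟩
  · simp only [Set.mem_ofPred_eq]
    field_simp

/-- Averaging the volume of `{x | t • x ∈ Z}` over `t` and exchanging the order of integration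
shows that `Z` is null, since every line through the origin meets `Z` in a null set. -/
lemma volume_gramEigenvalueSet {c : ℝ} (hc : c ≠ 0) :
    volume (gramEigenvalueSet k d c) = 0 := by
  set Z := gramEigenvalueSet k d c
  have hZ : MeasurableSet Z := (isClosed_gramEigenvalueSet c).measurableSet
  have hm : MeasurableSet {p : ℝ × RowSpace k d | p.1 • p.2 ∈ Z} :=
    hZ.preimage (f := fun p : ℝ × RowSpace k d => p.1 • p.2) (by fun_prop)
  have h0 : (volume.prod volume) {p : RowSpace k d × ℝ | p.2 • p.1 ∈ Z} = 0 := by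
    have hm' : MeasurableSet {p : RowSpace k d × ℝ | p.2 • p.1 ∈ Z} :=
      hZ.preimage (f := fun p : RowSpace k d × ℝ => p.2 • p.1) (by fun_prop)
    rw [Measure.measure_prod_null hm']
    exact Filter.Eventually.of_forall fun x =>
      (finite_setOf_smul_mem_gramEigenvalueSet hc x).measure_zero volume
  have h1 : (volume.prod volume) {p : ℝ × RowSpace k d | p.1 • p.2 ∈ Z} = 0 := by
    rw [← Measure.prod_swap, Measure.map_apply measurable_swap hm]
    exact h0
  rw [Measure.measure_prod_null hm] at h1
  have hne : ∀ᵐ t : ℝ, t ≠ 0 := by simp [ae_iff]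
  obtain ⟨t, ht, ht0⟩ := (h1.and hne).exists
  have h2 : volume ((fun x : RowSpace k d => t • x) ⁻¹' Z) = 0 := ht
  rw [Measure.addHaar_preimage_smul _ ht0] at h2
  refine (mul_eq_zero.1 h2).resolve_left ?_
  rw [ENNReal.ofReal_eq_zero, not_le]
  positivity

/-- If `w` is a unit vector at which the quadratic form of `gramOp x` attains its bound `c` on the
unit sphere, from above or from below, then `w` is an eigenvector for `c`. -/
lemma mem_gramEigenvalueSet_of_isExtr {c : ℝ} {x : RowSpace k d} {w : EuclideanSpace ℝ (Fin d)}
    (hw : w ∈ Metric.sphere (0 : EuclideanSpace ℝ (Fin d)) 1) (hwc : ∑ a, ⟪x a, w⟫ ^ 2 = c)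
    (hx : (∀ v : EuclideanSpace ℝ (Fin d), ∑ a, ⟪x a, v⟫ ^ 2 ≤ c * ‖v‖ ^ 2) ∨
      (∀ v : EuclideanSpace ℝ (Fin d), c * ‖v‖ ^ 2 ≤ ∑ a, ⟪x a, v⟫ ^ 2)) :
    x ∈ gramEigenvalueSet k d c := by
  have hw1 : ‖w‖ = 1 := by simpa using hw
  have hw0 : w ≠ 0 := by
    rintro rfl
    simp at hw1
  have hre : ∀ v, (gramOp x).reApplyInnerSelf v = ∑ a, ⟪x a, v⟫ ^ 2 := fun v => by
    rw [ContinuousLinearMap.reApplyInnerSelf_apply, inner_gramOp_self]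
    rfl
  have hsa : IsSelfAdjoint (gramOp x) :=
    (ContinuousLinearMap.isSelfAdjoint_iff_isSymmetric).2 (gramOp_isSymmetric x)
  have hextr : IsLocalExtrOn (gramOp x).reApplyInnerSelf (Metric.sphere 0 ‖w‖) w := by
    rcases hx with hx | hx
    · refine Or.inr (IsMaxOn.localize fun v hv => ?_)
      have hv1 : ‖v‖ = 1 := by simpa [hw1] using hv
      simpa [hre, hwc, hv1] using hx v
    · refine Or.inl (IsMinOn.localize fun v hv => ?_)
      have hv1 : ‖v‖ = 1 := by simpa [hw1] using hv
      simpa [hre, hwc, hv1] using hx v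
  refine ⟨w, hw, ?_⟩
  have h := hsa.eq_smul_self_of_isLocalExtrOn hextr
  rw [ContinuousLinearMap.rayleighQuotient, hre, hwc, hw1] at h
  simpa using h

/-- Boundary points of the embedding condition have an eigenvalue of the Gram matrix at one of the
endpoints `1 ± ε`. The endpoint `1 - ε` can be left out when it vanishes, as the lower bound is then
vacuous; this matters because `0` may be an eigenvalue with positive probability. -/
lemma frontier_nearIsometrySet_subset {ε : ℝ} :
    frontier (nearIsometrySet k d ε) ⊆
      gramEigenvalueSet k d (1 + ε) ∪ {x | ε ≠ 1 ∧ x ∈ gramEigenvalueSet k d (1 - ε)} := by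
  have hcont : Continuous fun q : EuclideanSpace ℝ (Fin d) × RowSpace k d =>
      ∑ a, ⟪q.2 a, q.1⟫ ^ 2 := by fun_prop
  have hhi : IsClosed {x : RowSpace k d | ∃ w ∈ Metric.sphere (0 : EuclideanSpace ℝ (Fin d)) 1,
      1 + ε ≤ ∑ a, ⟪x a, w⟫ ^ 2} :=
    isClosed_exists_mem_sphere (isClosed_le continuous_const hcont)
  have hlo : IsClosed {x : RowSpace k d | ∃ w ∈ Metric.sphere (0 : EuclideanSpace ℝ (Fin d)) 1,
      ε ≠ 1 ∧ ∑ a, ⟪x a, w⟫ ^ 2 ≤ 1 - ε} := by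
    by_cases h1 : ε = 1
    · simp [h1]
    · simpa [h1] using isClosed_exists_mem_sphere (isClosed_le hcont continuous_const)
  intro x hx
  rw [(isClosed_nearIsometrySet ε).frontier_eq] at hx
  obtain ⟨hxF, hxi⟩ := hx
  by_contra hcon
  simp only [Set.mem_union, Set.mem_ofPred_eq, not_or, not_and] at hcon
  refine hxi (mem_interior.2 ⟨_, ?_, (hhi.union hlo).isOpen_compl, ?_⟩)
  · intro y hy w
    simp only [Set.mem_compl_iff, Set.mem_union, Set.mem_ofPred_eq, not_or, not_exists, not_and,
      not_le] at hy
    by_cases hw : w = 0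
    · simp [hw]
    have hn : 0 < ‖w‖ := norm_pos_iff.2 hw
    have hmem : ‖w‖⁻¹ • w ∈ Metric.sphere (0 : EuclideanSpace ℝ (Fin d)) 1 := by
      simp [norm_smul, hn.ne']
    have hscale : ∑ a, ⟪y a, w⟫ ^ 2 = ‖w‖ ^ 2 * ∑ a, ⟪y a, ‖w‖⁻¹ • w⟫ ^ 2 := by
      rw [Finset.mul_sum]
      refine Finset.sum_congr rfl fun a _ => ?_
      rw [real_inner_smul_right]
      field_simp
    have hup := hy.1 _ hmem
    rw [hscale]
    constructor
    · by_cases h1 : ε = 1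
      · simp only [h1, sub_self, zero_mul]
        positivity
      · have := hy.2 _ hmem h1
        nlinarith [sq_nonneg ‖w‖]
    · nlinarith [sq_nonneg ‖w‖]
  · rintro (⟨w, hw, hge⟩ | ⟨w, hw, h1, hle⟩)
    · have hw1 : ‖w‖ = 1 := by simpa using hw
      refine hcon.1 (mem_gramEigenvalueSet_of_isExtr hw ?_ (Or.inl fun v => (hxF v).2))
      refine le_antisymm ?_ hge
      simpa [hw1] using (hxF w).2
    · have hw1 : ‖w‖ = 1 := by simpa using hw
      refine hcon.2 h1 (mem_gramEigenvalueSet_of_isExtr hw ?_ (Or.inr fun v => (hxF v).1))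
      refine le_antisymm hle ?_
      simpa [hw1] using (hxF w).1

/-- For negative `ε` no matrix satisfies the embedding condition. -/
lemma nearIsometrySet_eq_empty (hd : 1 ≤ d) {ε : ℝ} (hε : ε < 0) :
    nearIsometrySet k d ε = ∅ := by
  rw [Set.eq_empty_iff_forall_notMem]
  intro x hx
  have h1 := hx (EuclideanSpace.single ⟨0, hd⟩ 1)
  simp only [PiLp.norm_single, norm_one] at h1
  linarith [h1.1, h1.2]

lemma volume_frontier_nearIsometrySet (hd : 1 ≤ d) (ε : ℝ) :
    volume (frontier (nearIsometrySet k d ε)) = 0 := by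
  rcases lt_or_ge ε 0 with hε | hε
  · simp [nearIsometrySet_eq_empty hd hε]
  refine measure_mono_null frontier_nearIsometrySet_subset (measure_union_null ?_ ?_)
  · exact volume_gramEigenvalueSet (by linarith)
  · by_cases h1 : ε = 1
    · simp [h1]
    · simpa [h1] using volume_gramEigenvalueSet (sub_ne_zero.2 (Ne.symm h1))

/-! ### The Gaussian limit -/

/-- The law of a `k × d` matrix with independent `N(0, I_d / k)` rows. -/
noncomputable def gaussianRows (k d : ℕ) : Measure (RowSpace k d) :=
  (Measure.pi fun _ : Fin k => multivariateGaussian (0 : EuclideanSpace ℝ (Fin d))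
    ((1 / (k : ℝ)) • (1 : Matrix (Fin d) (Fin d) ℝ))).map (WithLp.toLp 2)

instance (k d : ℕ) : IsProbabilityMeasure (gaussianRows k d) :=
  Measure.isProbabilityMeasure_map (by fun_prop)

instance (m n : ℕ) : BorelSpace (Matrix (Fin m) (Fin n) ℝ) :=
  inferInstanceAs (BorelSpace (Fin m → Fin n → ℝ))

lemma charFun_gaussianRows (t : RowSpace k d) :
    charFun (gaussianRows k d) t = Complex.exp (-(‖t‖ ^ 2 / (2 * k) : ℝ)) := by
  have hS : ((1 / (k : ℝ)) • (1 : Matrix (Fin d) (Fin d) ℝ)).PosSemidef :=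
    Matrix.PosSemidef.one.smul (by positivity)
  rw [gaussianRows, charFun_pi]
  simp_rw [charFun_multivariateGaussian hS]
  rw [← Complex.exp_sum, PiLp.norm_sq_eq_of_L2, Finset.sum_div]
  push_cast
  rw [← Finset.sum_neg_distrib]
  congr 1
  refine Finset.sum_congr rfl fun a _ => ?_
  have h : (t a).ofLp ⬝ᵥ ((1 / (k : ℝ)) • (1 : Matrix (Fin d) (Fin d) ℝ)).mulVec (t a).ofLp =
      ‖t a‖ ^ 2 / k := by
    rw [Matrix.smul_mulVec, Matrix.one_mulVec, dotProduct_smul, EuclideanSpace.real_norm_sq_eq]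
    simp [dotProduct, sq, div_eq_inv_mul]
  rw [h]
  simp
  ring

lemma stdGaussian_map_smul_eq_gaussianRows :
    (stdGaussian (RowSpace k d)).map (fun x => (√(k : ℝ))⁻¹ • x) = gaussianRows k d := by
  have : IsProbabilityMeasure ((stdGaussian (RowSpace k d)).map fun x => (√(k : ℝ))⁻¹ • x) :=
    Measure.isProbabilityMeasure_map (by fun_prop)
  refine Measure.ext_of_charFun (funext fun t => ?_)
  have hnorm : ‖(√(k : ℝ))⁻¹ • t‖ ^ 2 = ‖t‖ ^ 2 / k := by
    rw [norm_smul, mul_pow, Real.norm_eq_abs, sq_abs, inv_pow, Real.sq_sqrt (Nat.cast_nonneg k)]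
    ring
  rw [charFun_map_smul, charFun_stdGaussian, charFun_gaussianRows, ← Complex.ofReal_pow, hnorm]
  push_cast
  congr 1
  ring

lemma pi_absolutelyContinuous {n : ℕ} {μ ν : Fin n → Measure ℝ} [∀ i, SigmaFinite (μ i)]
    [∀ i, SigmaFinite (ν i)] (h : ∀ i, μ i ≪ ν i) : Measure.pi μ ≪ Measure.pi ν := by
  induction n with
  | zero => rw [Measure.pi_of_empty, Measure.pi_of_empty]
  | succ n ih =>
    have hμ := (measurePreserving_piFinSuccAbove μ 0).symm
    have hν := (measurePreserving_piFinSuccAbove ν 0).symm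
    rw [← hμ.map_eq, ← hν.map_eq]
    exact ((h 0).prod (ih fun i => h _)).map hμ.measurable

lemma stdGaussian_absolutelyContinuous_volume : stdGaussian (RowSpace k d) ≪ volume := by
  set b := stdOrthonormalBasis ℝ (RowSpace k d)
  have hf : (fun x : Fin (Module.finrank ℝ (RowSpace k d)) → ℝ => ∑ i, x i • b i) =
      b.repr.symm ∘ WithLp.toLp 2 := by
    funext x
    simp [b.sum_repr_symm]
  have hpres := b.measurePreserving_repr_symm.comp
    (PiLp.volume_preserving_toLp (Fin (Module.finrank ℝ (RowSpace k d))))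
  rw [stdGaussian, hf, ← hpres.map_eq]
  exact (pi_absolutelyContinuous fun _ => gaussianReal_absolutelyContinuous 0 one_ne_zero).map
    hpres.measurable

lemma gaussianRows_absolutelyContinuous_volume (hk : 1 ≤ k) :
    gaussianRows k d ≪ volume := by
  have hk0 : (√(k : ℝ))⁻¹ ≠ 0 := by positivity
  rw [← stdGaussian_map_smul_eq_gaussianRows]
  refine Measure.AbsolutelyContinuous.mk fun s hs h0 => ?_
  rw [Measure.map_apply (by fun_prop) hs]
  refine stdGaussian_absolutelyContinuous_volume ?_
  rw [Measure.addHaar_preimage_smul _ hk0, h0, mul_zero]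

/-- The limiting probability in terms of the Gaussian matrix whose Gram matrix is Wishart. -/
lemma wishart_real_eq_gaussianRows_real (hd : 1 ≤ d) (ε : ℝ) :
    (wishart k ((1 / (k : ℝ)) • (1 : Matrix (Fin d) (Fin d) ℝ))).real
        {W | sigmaMax (1 - W) ≤ ε} = (gaussianRows k d).real (nearIsometrySet k d ε) := by
  have hcont : Continuous fun x : Fin k → EuclideanSpace ℝ (Fin d) =>
      ∑ r, Matrix.vecMulVec (x r).ofLp (x r).ofLp := by
    refine continuous_finsetSum _ fun r _ => ?_
    exact Continuous.matrix_vecMulVec (by fun_prop) (by fun_prop)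
  rw [wishart, gaussianRows, map_measureReal_apply hcont.measurable
    (isClosed_sigmaMax_one_sub_le hd ε).measurableSet,
    map_measureReal_apply (by fun_prop) (isClosed_nearIsometrySet ε).measurableSet]
  congr 1
  ext x
  exact sigmaMax_one_sub_gram_le_iff hd (WithLp.toLp 2 x) ε

/-- Random matrices whose characteristic functions converge to that of `gaussianRows` satisfy the
embedding condition with asymptotically the Gaussian probability. -/
lemma tendsto_real_nearIsometrySet (hd : 1 ≤ d) (hk : 1 ≤ k) (ε : ℝ)
    {μ : ℕ → Measure (RowSpace k d)} [∀ j, IsProbabilityMeasure (μ j)]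
    (h : ∀ t, Tendsto (fun j => charFun (μ j) t) atTop
      (𝓝 (Complex.exp (-(‖t‖ ^ 2 / (2 * k) : ℝ))))) :
    Tendsto (fun j => (μ j).real (nearIsometrySet k d ε)) atTop
      (𝓝 ((gaussianRows k d).real (nearIsometrySet k d ε))) := by
  let ν : ℕ → ProbabilityMeasure (RowSpace k d) := fun j => ⟨μ j, inferInstance⟩
  let ν₀ : ProbabilityMeasure (RowSpace k d) := ⟨gaussianRows k d, inferInstance⟩
  have hconv : Tendsto ν atTop (𝓝 ν₀) := by
    refine ProbabilityMeasure.tendsto_of_tendsto_charFun fun t => ?_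
    simpa [ν, ν₀, charFun_gaussianRows] using h t
  have h0 := ProbabilityMeasure.tendsto_measure_of_null_frontier_of_tendsto' hconv
    (gaussianRows_absolutelyContinuous_volume hk (volume_frontier_nearIsometrySet hd ε))
  exact (ENNReal.tendsto_toReal (measure_ne_top _ _)).comp h0

lemma continuous_toRows_mul {n : ℕ} (U : Matrix (Fin n) (Fin d) ℝ) :
    Continuous fun S : Matrix (Fin k) (Fin n) ℝ => toRows (S * U) := by
  have h : Continuous fun S : Matrix (Fin k) (Fin n) ℝ => S * U :=
    continuous_id.matrix_mul continuous_const
  exact (PiLp.continuous_toLp 2 _).comp (continuous_pi fun a =>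
    (PiLp.continuous_toLp 2 _).comp ((continuous_apply a).comp h))

/-- The sketched left singular vectors of a Gaussian sketch have exactly the limiting law. -/
lemma gaussianSketch_map_toRows_mul {n : ℕ} {U : Matrix (Fin n) (Fin d) ℝ}
    (hU : U.transpose * U = 1) :
    (gaussianSketch k n).map (fun S => toRows (S * U)) = gaussianRows k d := by
  have hrow : Measurable fun v : Fin n → ℝ => (WithLp.toLp 2 (Matrix.vecMul v U) : EuclideanSpace ℝ (Fin d)) :=
    (by fun_prop : Continuous _).measurable
  have hof : Measurable fun x : Fin k → Fin n → ℝ => Matrix.of x := measurable_id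
  have hlaw : (gaussianSketch k n).map (fun S => toRows (S * U)) =
      (Measure.pi fun _ : Fin k => (Measure.pi fun _ : Fin n =>
        gaussianReal 0 (1 / (k : NNReal))).map
          fun v => (WithLp.toLp 2 (Matrix.vecMul v U) : EuclideanSpace ℝ (Fin d))).map (WithLp.toLp 2) := by
    rw [gaussianSketch, Measure.map_map (continuous_toRows_mul U).measurable hof,
      ← Measure.pi_map_pi (fun _ => hrow.aemeasurable), Measure.map_map (by fun_prop) (by fun_prop)]
    rfl
  have : IsProbabilityMeasure ((Measure.pi fun _ : Fin n =>
        gaussianReal 0 (1 / (k : NNReal))).map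
          fun v => (WithLp.toLp 2 (Matrix.vecMul v U) : EuclideanSpace ℝ (Fin d))) :=
    Measure.isProbabilityMeasure_map hrow.aemeasurable
  have hfin : IsProbabilityMeasure ((gaussianSketch k n).map fun S => toRows (S * U)) := by
    rw [hlaw]
    exact Measure.isProbabilityMeasure_map (by fun_prop)
  refine Measure.ext_of_charFun (funext fun t => ?_)
  have hone : ∀ u : EuclideanSpace ℝ (Fin d), charFun ((Measure.pi fun _ : Fin n =>
        gaussianReal 0 (1 / (k : NNReal))).map
          fun v => (WithLp.toLp 2 (Matrix.vecMul v U) : EuclideanSpace ℝ (Fin d))) u =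
      Complex.exp (-(‖u‖ ^ 2 / (2 * k) : ℝ)) := fun u => by
    have hinner : ∀ v : Fin n → ℝ, ⟪(WithLp.toLp 2 (Matrix.vecMul v U) : EuclideanSpace ℝ (Fin d)), u⟫ =
        ⟪(WithLp.toLp 2 v : EuclideanSpace ℝ (Fin n)), WithLp.toLp 2 (U.mulVec u.ofLp)⟫ := fun v => by
      rw [EuclideanSpace.inner_toLp_toLp, ← WithLp.toLp_ofLp 2 u, EuclideanSpace.inner_toLp_toLp]
      simp only [star_trivial]
      rw [dotProduct_comm, ← Matrix.dotProduct_mulVec, dotProduct_comm]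
    have heq : charFun ((Measure.pi fun _ : Fin n =>
        gaussianReal 0 (1 / (k : NNReal))).map
          fun v => (WithLp.toLp 2 (Matrix.vecMul v U) : EuclideanSpace ℝ (Fin d))) u =
        charFun ((Measure.pi fun _ : Fin n => gaussianReal 0 (1 / (k : NNReal))).map
          (WithLp.toLp 2)) (WithLp.toLp 2 (U.mulVec u.ofLp)) := by
      rw [charFun_apply, charFun_apply, integral_map hrow.aemeasurable (by fun_prop),
        integral_map (by fun_prop) (by fun_prop)]
      simp_rw [hinner]
    rw [heq, charFun_pi]
    simp_rw [charFun_gaussianReal]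
    rw [← Complex.exp_sum, ← WithLp.toLp_ofLp 2 u, ← norm_mulVec_of_transpose_mul_self hU,
      EuclideanSpace.real_norm_sq_eq, Finset.sum_div]
    push_cast
    rw [← Finset.sum_neg_distrib]
    congr 1
    refine Finset.sum_congr rfl fun a _ => ?_
    simp
    ring
  rw [hlaw, charFun_pi, charFun_gaussianRows]
  simp_rw [hone]
  rw [← Complex.exp_sum, PiLp.norm_sq_eq_of_L2, Finset.sum_div]
  push_cast
  rw [← Finset.sum_neg_distrib]

/-! ### Elementary estimates -/

lemma abs_cos_sub_one_sub_sq_half_le (x : ℝ) : |Real.cos x - (1 - x ^ 2 / 2)| ≤ x ^ 4 / 2 := by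
  rcases le_or_gt |x| 1 with h | h
  · refine (Real.cos_bound h).trans ?_
    rw [(by decide : Even 4).pow_abs]
    have h4 : 0 ≤ x ^ 4 := by positivity
    linarith
  · rw [abs_of_nonneg (by linarith [Real.one_sub_sq_div_two_le_cos (x := x)])]
    have h1 : 1 < x ^ 2 := (one_lt_sq_iff_one_lt_abs x).2 h
    nlinarith [Real.cos_le_one x]

lemma abs_exp_neg_sub_one_sub_le {y : ℝ} (hy : 0 ≤ y) : |Real.exp (-y) - (1 - y)| ≤ y ^ 2 := by
  rcases le_or_gt y 1 with h | h
  · have := Real.abs_exp_sub_one_sub_id_le (x := -y) (by rwa [abs_neg, abs_of_nonneg hy])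
    rwa [neg_sq, (by ring : Real.exp (-y) - 1 - -y = Real.exp (-y) - (1 - y))] at this
  · have h1 : Real.exp (-y) ≤ 1 := Real.exp_le_one_iff.2 (by linarith)
    rw [abs_of_nonneg (by linarith [Real.add_one_le_exp (-y)])]
    nlinarith

lemma abs_exp_neg_sub_exp_neg_le {x y : ℝ} (hx : 0 ≤ x) (hy : 0 ≤ y) :
    |Real.exp (-x) - Real.exp (-y)| ≤ |x - y| := by
  wlog h : x ≤ y generalizing x y
  · rw [abs_sub_comm, abs_sub_comm x]
    exact this hy hx (le_of_not_ge h)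
  have h1 : Real.exp (-y) = Real.exp (-x) * Real.exp (x - y) := by
    rw [← Real.exp_add]
    ring_nf
  have h2 := Real.add_one_le_exp (x - y)
  have h3 : Real.exp (x - y) ≤ 1 := Real.exp_le_one_iff.2 (by linarith)
  have h4 : Real.exp (-x) ≤ 1 := Real.exp_le_one_iff.2 (by linarith)
  have h5 := Real.exp_pos (-x)
  rw [h1, abs_of_nonneg (by nlinarith), abs_of_nonpos (by linarith)]
  nlinarith

/-- Telescoping bound for the difference of two products with factors in `[-1, 1]`. -/
lemma abs_prod_sub_prod_le_sum {ι : Type*} (s : Finset ι) {f g : ι → ℝ}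
    (hf : ∀ i, |f i| ≤ 1) (hg : ∀ i, |g i| ≤ 1) :
    |∏ i ∈ s, f i - ∏ i ∈ s, g i| ≤ ∑ i ∈ s, |f i - g i| := by
  classical
  induction s using Finset.induction_on with
  | empty => simp
  | insert a s ha ih =>
    rw [Finset.prod_insert ha, Finset.prod_insert ha, Finset.sum_insert ha]
    have hP : |∏ i ∈ s, f i| ≤ 1 := by
      rw [Finset.abs_prod]
      exact Finset.prod_le_one (fun i _ => abs_nonneg _) fun i _ => hf i
    calc |f a * ∏ i ∈ s, f i - g a * ∏ i ∈ s, g i|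
        = |(f a - g a) * ∏ i ∈ s, f i + g a * (∏ i ∈ s, f i - ∏ i ∈ s, g i)| := by ring_nf
      _ ≤ |f a - g a| * |∏ i ∈ s, f i| + |g a| * |∏ i ∈ s, f i - ∏ i ∈ s, g i| := by
          rw [← abs_mul, ← abs_mul]
          exact abs_add_le _ _
      _ ≤ |f a - g a| * 1 + 1 * ∑ i ∈ s, |f i - g i| := by
          gcongr
          exact hg a
      _ = _ := by ring

/-! ### Random signs -/

instance : IsProbabilityMeasure rademacher := by
  constructor
  simp [rademacher, ENNReal.inv_two_add_inv_two]

lemma integral_cexp_rademacher (b : ℝ) :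
    ∫ x, Complex.exp ((x * b : ℝ) * Complex.I) ∂rademacher = (Real.cos b : ℂ) := by
  rw [rademacher, integral_add_measure, integral_smul_measure, integral_smul_measure,
    integral_dirac, integral_dirac, Complex.ofReal_cos, Complex.cos]
  · simp
    ring
  · exact (integrable_dirac (by simp)).smul_measure (by simp)
  · exact (integrable_dirac (by simp)).smul_measure (by simp)

variable {n : ℕ}

lemma inner_toRows_mul (S : Matrix (Fin k) (Fin n) ℝ) (U : Matrix (Fin n) (Fin d) ℝ)
    (t : RowSpace k d) :
    ⟪toRows (S * U), t⟫ = ∑ a, ∑ i, S a i * ⟪(WithLp.toLp 2 (U i) : EuclideanSpace ℝ (Fin d)), t a⟫ := by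
  rw [PiLp.inner_apply]
  refine Finset.sum_congr rfl fun a _ => ?_
  simp only [toRows_apply, PiLp.inner_apply, Matrix.mul_apply, Finset.mul_sum]
  rw [Finset.sum_comm]
  refine Finset.sum_congr rfl fun l _ => ?_
  simp only [RCLike.inner_apply, conj_trivial, Finset.mul_sum]
  exact Finset.sum_congr rfl fun i _ => by ring

lemma measurable_mul_diagonal {Ω : Type*} [Countable Ω] [MeasurableSpace Ω]
    [MeasurableSingletonClass Ω] (B : Ω → Matrix (Fin k) (Fin n) ℝ) :
    Measurable fun p : Ω × (Fin n → ℝ) => B p.1 * Matrix.diagonal p.2 := by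
  refine measurable_from_prod_countable_right fun ω => Continuous.measurable ?_
  exact (continuous_const.matrix_mul (continuous_id.matrix_diagonal) :
    Continuous fun D : Fin n → ℝ => B ω * Matrix.diagonal D)

/-- The characteristic function of `B D U`, where `B` is random with finitely many values and `D` is
an independent diagonal matrix of random signs: given `B`, the signs contribute a product of
cosines. -/
lemma charFun_map_toRows_mul_diagonal {Ω : Type*} [Finite Ω] [MeasurableSpace Ω]
    [MeasurableSingletonClass Ω] (P : Measure Ω) [IsProbabilityMeasure P]
    (B : Ω → Matrix (Fin k) (Fin n) ℝ) (U : Matrix (Fin n) (Fin d) ℝ) (t : RowSpace k d) :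
    charFun (((P.prod (Measure.pi fun _ : Fin n => rademacher)).map
        fun p => B p.1 * Matrix.diagonal p.2).map fun S => toRows (S * U)) t =
      ((∫ ω, ∏ i, Real.cos (∑ a, B ω a i *
        ⟪(WithLp.toLp 2 (U i) : EuclideanSpace ℝ (Fin d)), t a⟫) ∂P : ℝ) : ℂ) := by
  have hB := measurable_mul_diagonal B
  have hU := (continuous_toRows_mul (k := k) U).measurable
  rw [charFun_apply, integral_map hU.aemeasurable (by fun_prop),
    integral_map hB.aemeasurable
      (by
        refine Measurable.aestronglyMeasurable ?_
        exact Complex.continuous_exp.measurable.comp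
          ((Complex.measurable_ofReal.comp (hU.inner measurable_const)).mul_const _))]
  have hint : Integrable (fun p : Ω × (Fin n → ℝ) =>
      Complex.exp ((⟪toRows (B p.1 * Matrix.diagonal p.2 * U), t⟫ : ℝ) * Complex.I))
      (P.prod (Measure.pi fun _ : Fin n => rademacher)) := by
    refine Integrable.of_bound (C := 1) (Measurable.aestronglyMeasurable ?_) ?_
    · exact Complex.continuous_exp.measurable.comp
          ((Complex.measurable_ofReal.comp ((hU.comp hB).inner measurable_const)).mul_const _)
    · exact Filter.Eventually.of_forall fun p => (Complex.norm_exp_ofReal_mul_I _).le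
  rw [integral_prod _ hint, ← integral_complex_ofReal]
  congr 1
  funext ω
  have hexp : ∀ D : Fin n → ℝ,
      Complex.exp ((⟪toRows (B ω * Matrix.diagonal D * U), t⟫ : ℝ) * Complex.I) =
      ∏ i, Complex.exp ((D i * ∑ a, B ω a i *
        ⟪(WithLp.toLp 2 (U i) : EuclideanSpace ℝ (Fin d)), t a⟫ : ℝ) * Complex.I) := fun D => by
    rw [← Complex.exp_sum, ← Finset.sum_mul, ← Complex.ofReal_sum, inner_toRows_mul,
      Finset.sum_comm]
    simp only [Matrix.mul_diagonal, Finset.mul_sum]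
    congr 4
    funext i
    exact Finset.sum_congr rfl fun a _ => by ring
  simp_rw [hexp]
  rw [integral_fintype_prod_eq_prod (f := fun i (x : ℝ) => Complex.exp ((x * ∑ a, B ω a i *
        ⟪(WithLp.toLp 2 (U i) : EuclideanSpace ℝ (Fin d)), t a⟫ : ℝ) * Complex.I))]
  simp_rw [integral_cexp_rademacher]
  push_cast
  rfl

lemma isProbabilityMeasure_map_toRows {Ω : Type*} [Finite Ω] [MeasurableSpace Ω]
    [MeasurableSingletonClass Ω] (P : Measure Ω) [IsProbabilityMeasure P]
    (B : Ω → Matrix (Fin k) (Fin n) ℝ) (U : Matrix (Fin n) (Fin d) ℝ) :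
    IsProbabilityMeasure (((P.prod (Measure.pi fun _ : Fin n => rademacher)).map
        fun p => B p.1 * Matrix.diagonal p.2).map fun S => toRows (S * U)) :=
  have := Measure.isProbabilityMeasure_map
    (μ := P.prod (Measure.pi fun _ : Fin n => rademacher)) (measurable_mul_diagonal B).aemeasurable
  Measure.isProbabilityMeasure_map (continuous_toRows_mul U).measurable.aemeasurable

lemma integral_uniformOn_univ {ι : Type*} [Fintype ι] [Nonempty ι] [MeasurableSpace ι]
    [MeasurableSingletonClass ι] (f : ι → ℝ) :
    ∫ x, f x ∂(uniformOn (Set.univ : Set ι)) = (Fintype.card ι : ℝ)⁻¹ * ∑ x, f x := by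
  rw [integral_fintype Integrable.of_finite, Finset.mul_sum]
  refine Finset.sum_congr rfl fun x _ => ?_
  rw [smul_eq_mul, measureReal_def, uniformOn_univ]
  simp

/-! ### Orthonormal columns -/

lemma sum_sq_inner_row {U : Matrix (Fin n) (Fin d) ℝ} (hU : U.transpose * U = 1)
    (w : EuclideanSpace ℝ (Fin d)) :
    ∑ i, ⟪(WithLp.toLp 2 (U i) : EuclideanSpace ℝ (Fin d)), w⟫ ^ 2 = ‖w‖ ^ 2 := by
  rw [← WithLp.toLp_ofLp 2 w, ← norm_mulVec_of_transpose_mul_self hU, norm_sq_mulVec_eq_sum_inner]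
  rfl

lemma sum_norm_sq_row {U : Matrix (Fin n) (Fin d) ℝ} (hU : U.transpose * U = 1) :
    ∑ i, ‖(WithLp.toLp 2 (U i) : EuclideanSpace ℝ (Fin d))‖ ^ 2 = d := by
  have h : (U.transpose * U).trace = d := by simp [hU]
  rw [← h, Matrix.trace]
  simp_rw [EuclideanSpace.real_norm_sq_eq, Matrix.diag_apply, Matrix.mul_apply,
    Matrix.transpose_apply, sq]
  rw [Finset.sum_comm]

lemma sq_inner_le {L : ℝ} {u w : EuclideanSpace ℝ (Fin d)} (hu : ‖u‖ ^ 2 ≤ L) :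
    ⟪u, w⟫ ^ 2 ≤ L * ‖w‖ ^ 2 := by
  have h := abs_real_inner_le_norm u w
  calc ⟪u, w⟫ ^ 2 = |⟪u, w⟫| ^ 2 := (sq_abs _).symm
    _ ≤ (‖u‖ * ‖w‖) ^ 2 := by gcongr
    _ = ‖u‖ ^ 2 * ‖w‖ ^ 2 := mul_pow _ _ _
    _ ≤ L * ‖w‖ ^ 2 := by gcongr

lemma norm_row_sq_le (t : RowSpace k d) (a : Fin k) : ‖t a‖ ^ 2 ≤ ‖t‖ ^ 2 := by
  gcongr
  exact PiLp.norm_apply_le t a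

/-! ### The Clarkson–Woodruff sketch -/

lemma clarksonWoodruff_charFun (hk : 1 ≤ k) (U : Matrix (Fin n) (Fin d) ℝ) (t : RowSpace k d) :
    charFun ((clarksonWoodruffSketch k n).map fun S => toRows (S * U)) t =
      ((∏ i, ((k : ℝ)⁻¹ * ∑ a,
        Real.cos ⟪(WithLp.toLp 2 (U i) : EuclideanSpace ℝ (Fin d)), t a⟫) : ℝ) : ℂ) := by
  have : Nonempty (Fin k) := ⟨⟨0, hk⟩⟩
  rw [clarksonWoodruffSketch, charFun_map_toRows_mul_diagonal]
  congr 1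
  have hsum : ∀ (c : Fin n → Fin k) (i : Fin n), ∑ a, columnHash c a i *
      ⟪(WithLp.toLp 2 (U i) : EuclideanSpace ℝ (Fin d)), t a⟫ =
      ⟪(WithLp.toLp 2 (U i) : EuclideanSpace ℝ (Fin d)), t (c i)⟫ := fun c i => by
    simp [columnHash]
  simp_rw [hsum]
  rw [integral_fintype_prod_eq_prod (f := fun i (a : Fin k) =>
    Real.cos ⟪(WithLp.toLp 2 (U i) : EuclideanSpace ℝ (Fin d)), t a⟫)]
  simp_rw [integral_uniformOn_univ, Fintype.card_fin]

/-- Quantitative comparison of the characteristic function of the Clarkson–Woodruff sketch with the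
Gaussian one, in terms of a bound `L` on the leverage scores. -/
lemma abs_clarksonWoodruff_prod_sub_exp_le (hk : 1 ≤ k) {U : Matrix (Fin n) (Fin d) ℝ}
    (hU : U.transpose * U = 1) {L : ℝ} (hL0 : 0 ≤ L)
    (hL : ∀ i, ‖(WithLp.toLp 2 (U i) : EuclideanSpace ℝ (Fin d))‖ ^ 2 ≤ L) (t : RowSpace k d) :
    |∏ i, ((k : ℝ)⁻¹ * ∑ a, Real.cos ⟪(WithLp.toLp 2 (U i) : EuclideanSpace ℝ (Fin d)), t a⟫) -
      Real.exp (-(‖t‖ ^ 2 / (2 * k)))| ≤ L * ‖t‖ ^ 4 := by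
  set α : Fin n → Fin k → ℝ :=
    fun i a => ⟪(WithLp.toLp 2 (U i) : EuclideanSpace ℝ (Fin d)), t a⟫ with hα
  set T := ‖t‖ ^ 2 with hT
  have hT0 : 0 ≤ T := sq_nonneg _
  have hk1 : (1 : ℝ) ≤ k := by exact_mod_cast hk
  have hk0 : (0 : ℝ) < k := by linarith
  have hk2 : (k : ℝ)⁻¹ ≤ 1 := inv_le_one_of_one_le₀ hk1
  have hTsum : T = ∑ a, ‖t a‖ ^ 2 := PiLp.norm_sq_eq_of_L2 _ t
  -- `y i` is half the variance contributed by the row `i`.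
  set y : Fin n → ℝ := fun i => (k : ℝ)⁻¹ * ∑ a, α i a ^ 2 / 2 with hy
  have hy0 : ∀ i, 0 ≤ y i := fun i => by positivity
  have hysum : ∑ i, y i = T / (2 * k) := by
    simp only [hy]
    rw [← Finset.mul_sum, Finset.sum_comm]
    simp_rw [← Finset.sum_div]
    simp only [hα, sum_sq_inner_row hU, ← hTsum]
    field_simp
  have hαL : ∀ i a, α i a ^ 2 ≤ L * T := fun i a =>
    (sq_inner_le (hL i)).trans (by gcongr; exact norm_row_sq_le t a)
  have hyL : ∀ i, y i ≤ L * T := fun i => by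
    have h1 : ∑ a, α i a ^ 2 ≤ L * T := by
      rw [hTsum, Finset.mul_sum]
      exact Finset.sum_le_sum fun a _ => sq_inner_le (hL i)
    have h2 : 0 ≤ ∑ a, α i a ^ 2 := by positivity
    calc y i = (k : ℝ)⁻¹ * ((∑ a, α i a ^ 2) / 2) := by rw [Finset.sum_div]
      _ ≤ 1 * ((∑ a, α i a ^ 2) / 2) := by gcongr
      _ ≤ L * T := by linarith
  have hcos1 : ∀ i, |(k : ℝ)⁻¹ * ∑ a, Real.cos (α i a)| ≤ 1 := fun i => by
    rw [abs_mul, abs_of_pos (inv_pos.2 hk0)]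
    have : |∑ a, Real.cos (α i a)| ≤ k := by
      refine (Finset.abs_sum_le_sum_abs _ _).trans ?_
      refine (Finset.sum_le_sum fun a _ => Real.abs_cos_le_one (α i a)).trans ?_
      simp
    calc (k : ℝ)⁻¹ * |∑ a, Real.cos (α i a)| ≤ (k : ℝ)⁻¹ * k := by gcongr
      _ = 1 := inv_mul_cancel₀ hk0.ne'
  have hexp1 : ∀ i, |Real.exp (-y i)| ≤ 1 := fun i => by
    rw [abs_of_pos (Real.exp_pos _), Real.exp_le_one_iff]
    linarith [hy0 i]
  have hfac : ∀ i, |(k : ℝ)⁻¹ * ∑ a, Real.cos (α i a) - Real.exp (-y i)| ≤ 2 * (L * T) * y i := by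
    intro i
    have h1 : |(k : ℝ)⁻¹ * ∑ a, Real.cos (α i a) - (1 - y i)| ≤ L * T * y i := by
      have hrw : (k : ℝ)⁻¹ * ∑ a, Real.cos (α i a) - (1 - y i) =
          (k : ℝ)⁻¹ * ∑ a, (Real.cos (α i a) - (1 - α i a ^ 2 / 2)) := by
        simp only [Finset.sum_sub_distrib, hy]
        simp only [Finset.sum_const, Finset.card_univ, Fintype.card_fin, nsmul_eq_mul, mul_one]
        field_simp
      rw [hrw, abs_mul, abs_of_pos (inv_pos.2 hk0)]
      calc (k : ℝ)⁻¹ * |∑ a, (Real.cos (α i a) - (1 - α i a ^ 2 / 2))|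
          ≤ (k : ℝ)⁻¹ * ∑ a, L * T * (α i a ^ 2 / 2) := by
            gcongr
            refine (Finset.abs_sum_le_sum_abs _ _).trans (Finset.sum_le_sum fun a _ => ?_)
            refine (abs_cos_sub_one_sub_sq_half_le _).trans ?_
            have := hαL i a
            nlinarith [sq_nonneg (α i a)]
        _ = L * T * y i := by
            rw [← Finset.mul_sum]
            ring
    have h2 := abs_exp_neg_sub_one_sub_le (hy0 i)
    have h3 : y i ^ 2 ≤ L * T * y i := by nlinarith [hy0 i, hyL i]
    calc _ ≤ |(k : ℝ)⁻¹ * ∑ a, Real.cos (α i a) - (1 - y i)| + |(1 - y i) - Real.exp (-y i)| :=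
          abs_sub_le _ _ _
      _ ≤ L * T * y i + L * T * y i := by
          rw [abs_sub_comm (1 - y i)]
          exact add_le_add h1 (h2.trans h3)
      _ = _ := by ring
  have hexp : Real.exp (-(T / (2 * k))) = ∏ i, Real.exp (-y i) := by
    rw [← Real.exp_sum, Finset.sum_neg_distrib, hysum]
  rw [hexp]
  calc _ ≤ ∑ i, |(k : ℝ)⁻¹ * ∑ a, Real.cos (α i a) - Real.exp (-y i)| :=
        abs_prod_sub_prod_le_sum _ hcos1 hexp1
    _ ≤ ∑ i, 2 * (L * T) * y i := Finset.sum_le_sum fun i _ => hfac i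
    _ = (k : ℝ)⁻¹ * (L * T * T) := by
        rw [← Finset.mul_sum, hysum]
        field_simp
    _ ≤ 1 * (L * T * T) := by gcongr
    _ = L * ‖t‖ ^ 4 := by
        rw [hT]
        ring

/-! ### The Hadamard sketch -/

variable {m : ℕ}

/-- The law of `k` row indices drawn independently and uniformly from `Fin m`. -/
noncomputable abbrev uniformRows (k m : ℕ) : Measure (Fin k → Fin m) :=
  Measure.pi fun _ : Fin k => uniformOn (Set.univ : Set (Fin m))

lemma hadamardSketch_eq (H : Matrix (Fin m) (Fin m) ℝ) :
    hadamardSketch k H = ((uniformRows k m).prod (Measure.pi fun _ : Fin m => rademacher)).map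
      fun p => ((√(k : ℝ))⁻¹ • (rowSelection p.1 * H)) * Matrix.diagonal p.2 := by
  simp only [hadamardSketch, Matrix.smul_mul]

lemma rowSelection_mul_apply (H : Matrix (Fin m) (Fin m) ℝ) (r : Fin k → Fin m) (a : Fin k)
    (i : Fin m) : (rowSelection r * H) a i = H (r a) i := by
  simp [rowSelection, Matrix.mul_apply]

/-- Distinct columns of a Hadamard matrix are orthogonal and its entries are `±1`, so the entries of
a uniformly random row are uncorrelated with unit variance. -/
lemma integral_hadamard_row_mul [Nonempty (Fin m)] {H : Matrix (Fin m) (Fin m) ℝ}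
    (hH : H.IsHadamard) (i j : Fin m) :
    ∫ x, H x i * H x j ∂(uniformOn (Set.univ : Set (Fin m))) = if i = j then 1 else 0 := by
  have h := congrFun (congrFun hH.conjTranspose_mul i) j
  simp only [Matrix.mul_apply, Matrix.conjTranspose_apply, star_trivial, Fintype.card_fin,
    Matrix.smul_apply, Matrix.one_apply] at h
  have hm : (m : ℝ) ≠ 0 := by
    have := Fin.pos_iff_nonempty.2 ‹Nonempty (Fin m)›
    positivity
  rw [integral_uniformOn_univ, h, Fintype.card_fin]
  split_ifs <;> simp [hm]

/-- Two distinct sampled rows of a Hadamard matrix give nearly uncorrelated sums: the second moment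
of their weighted inner product is the sum of the squared weights. -/
lemma integral_sq_sum_hadamard [Nonempty (Fin m)] {H : Matrix (Fin m) (Fin m) ℝ}
    (hH : H.IsHadamard) {a b : Fin k} (hab : a ≠ b) (w : Fin m → ℝ) :
    ∫ r, (∑ i, H (r a) i * H (r b) i * w i) ^ 2 ∂(uniformRows k m) = ∑ i, w i ^ 2 := by
  have hpair : ∀ i j, ∫ r, (H (r a) i * H (r a) j) * (H (r b) i * H (r b) j) ∂(uniformRows k m) =
      if i = j then 1 else 0 := fun i j => by
    have hprod : ∀ r : Fin k → Fin m, (H (r a) i * H (r a) j) * (H (r b) i * H (r b) j) =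
        ∏ c, if c = a ∨ c = b then H (r c) i * H (r c) j else 1 := fun r => by
      rw [Finset.prod_ite, Finset.prod_const_one, mul_one,
        (by ext; simp : Finset.univ.filter (fun c => c = a ∨ c = b) = {a, b}),
        Finset.prod_pair hab]
    simp_rw [hprod]
    rw [integral_fintype_prod_eq_prod (f := fun (c : Fin k) (x : Fin m) =>
      if c = a ∨ c = b then H x i * H x j else 1)]
    have hc : ∀ c : Fin k, (∫ x, (if c = a ∨ c = b then H x i * H x j else 1)
        ∂(uniformOn (Set.univ : Set (Fin m)))) =
        if c = a ∨ c = b then (if i = j then 1 else 0) else 1 := fun c => by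
      by_cases h : c = a ∨ c = b
      · simp only [h, if_true]
        exact integral_hadamard_row_mul hH i j
      · simp [h]
    simp_rw [hc]
    by_cases hij : i = j
    · simp [hij]
    · simp only [hij, if_false]
      exact Finset.prod_eq_zero (Finset.mem_univ a) (by simp)
  have hexpand : ∀ r : Fin k → Fin m, (∑ i, H (r a) i * H (r b) i * w i) ^ 2 =
      ∑ i, ∑ j, (w i * w j) * ((H (r a) i * H (r a) j) * (H (r b) i * H (r b) j)) := fun r => by
    rw [sq, Finset.sum_mul_sum]
    exact Finset.sum_congr rfl fun i _ => Finset.sum_congr rfl fun j _ => by ring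
  simp_rw [hexpand]
  rw [integral_finsetSum _ fun i _ => Integrable.of_finite]
  refine Finset.sum_congr rfl fun i _ => ?_
  rw [integral_finsetSum _ fun j _ => Integrable.of_finite]
  simp_rw [integral_const_mul, hpair]
  simp [sq]

lemma integral_abs_le_sqrt_integral_sq {Ω : Type*} [MeasurableSpace Ω] [Finite Ω]
    [MeasurableSingletonClass Ω] (P : Measure Ω) [IsProbabilityMeasure P] (f : Ω → ℝ) :
    ∫ ω, |f ω| ∂P ≤ √(∫ ω, f ω ^ 2 ∂P) := by
  refine Real.le_sqrt_of_sq_le ?_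
  have hf : MemLp (fun ω => |f ω|) 2 P := MemLp.of_discrete
  have h := variance_nonneg (fun ω => |f ω|) P
  rw [variance_eq_sub hf] at h
  simpa using h

/-- Quantitative comparison of the characteristic function of the Hadamard sketch with the Gaussian
one. The first term is the error of replacing cosines by Gaussian factors given the sampled rows;
the second is the fluctuation of the conditional covariance. -/
lemma abs_hadamard_integral_sub_exp_le (hk : 1 ≤ k) [Nonempty (Fin m)]
    {H : Matrix (Fin m) (Fin m) ℝ} (hH : H.IsHadamard) {U : Matrix (Fin m) (Fin d) ℝ}
    (hU : U.transpose * U = 1) {L : ℝ} (hL0 : 0 ≤ L)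
    (hL : ∀ i, ‖(WithLp.toLp 2 (U i) : EuclideanSpace ℝ (Fin d))‖ ^ 2 ≤ L) (t : RowSpace k d) :
    |∫ r, ∏ i, Real.cos (∑ a, ((√(k : ℝ))⁻¹ • (rowSelection r * H)) a i *
        ⟪(WithLp.toLp 2 (U i) : EuclideanSpace ℝ (Fin d)), t a⟫) ∂(uniformRows k m) -
      Real.exp (-(‖t‖ ^ 2 / (2 * k)))| ≤
      L * d * ‖t‖ ^ 4 + k * (√L * ‖t‖ ^ 2) := by
  set α : Fin m → Fin k → ℝ :=
    fun i a => ⟪(WithLp.toLp 2 (U i) : EuclideanSpace ℝ (Fin d)), t a⟫ with hα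
  set T := ‖t‖ ^ 2 with hT
  have hT0 : 0 ≤ T := sq_nonneg _
  have hk1 : (1 : ℝ) ≤ k := by exact_mod_cast hk
  have hk0 : (0 : ℝ) < k := by linarith
  have hTsum : T = ∑ a, ‖t a‖ ^ 2 := PiLp.norm_sq_eq_of_L2 _ t
  have hHsq : ∀ x i, H x i ^ 2 = 1 := fun x i => by
    have := (Unitary.mem_iff.1 (hH.apply_mem x i)).1
    simpa [sq] using this
  set b : (Fin k → Fin m) → Fin m → ℝ := fun r i => (√(k : ℝ))⁻¹ * ∑ a, H (r a) i * α i a with hb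
  set Q : (Fin k → Fin m) → ℝ := fun r => ∑ i, b r i ^ 2 with hQ
  have hbsq : ∀ r i, b r i ^ 2 = (k : ℝ)⁻¹ * (∑ a, H (r a) i * α i a) ^ 2 := fun r i => by
    simp only [hb]
    rw [mul_pow, inv_pow, Real.sq_sqrt hk0.le]
  have hbα : ∀ r i, b r i ^ 2 ≤ ∑ a, α i a ^ 2 := fun r i => by
    have h := sq_sum_le_card_mul_sum_sq (s := (Finset.univ : Finset (Fin k)))
      (f := fun a => H (r a) i * α i a)
    simp only [mul_pow, hHsq, one_mul, Finset.card_univ, Fintype.card_fin] at h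
    rw [hbsq, inv_mul_le_iff₀ hk0]
    exact h
  have hbu : ∀ r i, b r i ^ 2 ≤ ‖(WithLp.toLp 2 (U i) : EuclideanSpace ℝ (Fin d))‖ ^ 2 * T :=
    fun r i => by
      refine (hbα r i).trans ?_
      rw [hTsum, Finset.mul_sum]
      exact Finset.sum_le_sum fun a _ => sq_inner_le le_rfl
  have hbL : ∀ r i, b r i ^ 2 ≤ L * T := fun r i => (hbu r i).trans (by gcongr; exact hL i)
  have hQ0 : ∀ r, 0 ≤ Q r := fun r => Finset.sum_nonneg fun i _ => sq_nonneg _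
  have hQd : ∀ r, Q r ≤ d * T := fun r => by
    rw [← sum_norm_sq_row hU, Finset.sum_mul]
    exact Finset.sum_le_sum fun i _ => hbu r i
  -- Given the sampled rows, the signs give nearly Gaussian sums.
  have hcond : ∀ r, |∏ i, Real.cos (b r i) - Real.exp (-(Q r / 2))| ≤ L * d * ‖t‖ ^ 4 := by
    intro r
    have hexp : Real.exp (-(Q r / 2)) = ∏ i, Real.exp (-(b r i ^ 2 / 2)) := by
      rw [← Real.exp_sum, Finset.sum_neg_distrib, ← Finset.sum_div]
    have hfac : ∀ i, |Real.cos (b r i) - Real.exp (-(b r i ^ 2 / 2))| ≤ L * T * b r i ^ 2 := by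
      intro i
      have h1 := abs_cos_sub_one_sub_sq_half_le (b r i)
      have h2 := abs_exp_neg_sub_one_sub_le (y := b r i ^ 2 / 2) (by positivity)
      calc _ ≤ |Real.cos (b r i) - (1 - b r i ^ 2 / 2)| +
            |(1 - b r i ^ 2 / 2) - Real.exp (-(b r i ^ 2 / 2))| := abs_sub_le _ _ _
        _ ≤ b r i ^ 4 / 2 + (b r i ^ 2 / 2) ^ 2 := by
            rw [abs_sub_comm (1 - b r i ^ 2 / 2)]
            exact add_le_add h1 h2
        _ ≤ L * T * b r i ^ 2 := by nlinarith [hbL r i, sq_nonneg (b r i)]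
    rw [hexp]
    calc _ ≤ ∑ i, |Real.cos (b r i) - Real.exp (-(b r i ^ 2 / 2))| := by
          refine abs_prod_sub_prod_le_sum _ (fun i => Real.abs_cos_le_one _) fun i => ?_
          rw [abs_of_pos (Real.exp_pos _), Real.exp_le_one_iff]
          linarith [sq_nonneg (b r i)]
      _ ≤ ∑ i, L * T * b r i ^ 2 := Finset.sum_le_sum fun i _ => hfac i
      _ = L * T * Q r := by rw [← Finset.mul_sum]
      _ ≤ L * T * (d * T) := by gcongr; exact hQd r
      _ = L * d * ‖t‖ ^ 4 := by rw [hT]; ring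
  -- The conditional variance deviates from its mean only through pairs of different rows.
  set Y : Fin k → Fin k → (Fin k → Fin m) → ℝ :=
    fun a c r => ∑ i, H (r a) i * H (r c) i * (α i a * α i c) with hY
  have hQT : ∀ r, Q r - T / k =
      (k : ℝ)⁻¹ * ∑ a, ∑ c, if a = c then 0 else Y a c r := fun r => by
    have h1 : Q r = (k : ℝ)⁻¹ * ∑ a, ∑ c, Y a c r := by
      simp only [hQ, hbsq, hY]
      rw [← Finset.mul_sum]
      congr 1
      simp_rw [sq, Finset.sum_mul_sum]
      rw [Finset.sum_comm]
      refine Finset.sum_congr rfl fun a _ => ?_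
      rw [Finset.sum_comm]
      exact Finset.sum_congr rfl fun c _ => Finset.sum_congr rfl fun i _ => by ring
    have h2 : T = ∑ a, ∑ c, if a = c then Y a c r else 0 := by
      simp only [Finset.sum_ite_eq, Finset.mem_univ, if_true, hY]
      rw [hTsum]
      refine Finset.sum_congr rfl fun a _ => ?_
      rw [← sum_sq_inner_row hU (t a)]
      refine Finset.sum_congr rfl fun i _ => ?_
      rw [← sq, ← sq, hHsq, one_mul]
    rw [h1, div_eq_inv_mul]
    nth_rewrite 1 [h2]
    rw [← mul_sub, ← Finset.sum_sub_distrib]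
    congr 1
    refine Finset.sum_congr rfl fun a _ => ?_
    rw [← Finset.sum_sub_distrib]
    exact Finset.sum_congr rfl fun c _ => by split_ifs <;> simp
  have hYint : ∀ a c, a ≠ c → ∫ r, |Y a c r| ∂(uniformRows k m) ≤ √L * T := fun a c hac => by
    refine (integral_abs_le_sqrt_integral_sq _ _).trans ?_
    rw [integral_sq_sum_hadamard hH hac]
    have h : ∑ i, (α i a * α i c) ^ 2 ≤ L * T ^ 2 := by
      calc ∑ i, (α i a * α i c) ^ 2 ≤ ∑ i, (L * T) * α i c ^ 2 := by
            refine Finset.sum_le_sum fun i _ => ?_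
            rw [mul_pow]
            gcongr
            exact (sq_inner_le (hL i)).trans (by gcongr; exact norm_row_sq_le t a)
        _ = L * T * ‖t c‖ ^ 2 := by
            rw [← Finset.mul_sum]
            simp only [hα, sum_sq_inner_row hU]
        _ ≤ L * T * T := by gcongr; exact norm_row_sq_le t c
        _ = L * T ^ 2 := by ring
    calc _ ≤ √(L * T ^ 2) := Real.sqrt_le_sqrt h
      _ = √L * T := by rw [Real.sqrt_mul hL0, Real.sqrt_sq hT0]
  have hvar : ∫ r, |Real.exp (-(Q r / 2)) - Real.exp (-(T / (2 * k)))| ∂(uniformRows k m) ≤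
      k * (√L * T) := by
    have hpt : ∀ r, |Real.exp (-(Q r / 2)) - Real.exp (-(T / (2 * k)))| ≤
        (k : ℝ)⁻¹ * ∑ a, ∑ c, if a = c then 0 else |Y a c r| := fun r => by
      calc _ ≤ |Q r / 2 - T / (2 * k)| :=
            abs_exp_neg_sub_exp_neg_le (by linarith [hQ0 r]) (by positivity)
        _ = |Q r - T / k| / 2 := by
            rw [(by field_simp : Q r / 2 - T / (2 * k) = (Q r - T / k) / 2), abs_div, abs_two]
        _ ≤ |Q r - T / k| := half_le_self (abs_nonneg _)
        _ = (k : ℝ)⁻¹ * |∑ a, ∑ c, if a = c then 0 else Y a c r| := by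
            rw [hQT, abs_mul, abs_of_pos (inv_pos.2 hk0)]
        _ ≤ _ := by
            gcongr
            refine (Finset.abs_sum_le_sum_abs _ _).trans (Finset.sum_le_sum fun a _ => ?_)
            refine (Finset.abs_sum_le_sum_abs _ _).trans (Finset.sum_le_sum fun c _ => ?_)
            split_ifs <;> simp
    refine (integral_mono Integrable.of_finite Integrable.of_finite hpt).trans ?_
    rw [integral_const_mul, integral_finsetSum _ fun a _ => Integrable.of_finite]
    simp_rw [integral_finsetSum _ fun _ _ => Integrable.of_finite]
    have hterm : ∀ a c : Fin k, ∫ r, (if a = c then 0 else |Y a c r|) ∂(uniformRows k m) ≤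
        √L * T := fun a c => by
      by_cases hac : a = c
      · simp only [hac, if_true, integral_zero]
        positivity
      · simpa only [hac, if_false] using hYint a c hac
    calc _ ≤ (k : ℝ)⁻¹ * ∑ a : Fin k, ∑ c : Fin k, √L * T := by
          gcongr with a _ c _
          exact hterm a c
      _ = k * (√L * T) := by
          simp only [Finset.sum_const, Finset.card_univ, Fintype.card_fin, nsmul_eq_mul]
          field_simp
  have hbeq : ∀ r i, ∑ a, ((√(k : ℝ))⁻¹ • (rowSelection r * H)) a i * α i a = b r i :=
    fun r i => by
      simp only [hb, Matrix.smul_apply, rowSelection_mul_apply, smul_eq_mul, Finset.mul_sum,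
        mul_assoc]
  rw [integral_congr_ae (Filter.Eventually.of_forall fun r =>
    Finset.prod_congr rfl fun i _ => congrArg Real.cos (hbeq r i))]
  have hconst : Real.exp (-(T / (2 * k))) =
      ∫ _, Real.exp (-(T / (2 * k))) ∂(uniformRows k m) := by simp
  rw [hconst, ← integral_sub Integrable.of_finite Integrable.of_finite]
  refine abs_integral_le_integral_abs.trans ?_
  calc _ ≤ ∫ r, (L * d * ‖t‖ ^ 4 +
          |Real.exp (-(Q r / 2)) - Real.exp (-(T / (2 * k)))|) ∂(uniformRows k m) := by
        refine integral_mono Integrable.of_finite Integrable.of_finite fun r => ?_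
        exact (abs_sub_le _ (Real.exp (-(Q r / 2))) _).trans (by gcongr; exact hcond r)
    _ = L * d * ‖t‖ ^ 4 +
          ∫ r, |Real.exp (-(Q r / 2)) - Real.exp (-(T / (2 * k)))| ∂(uniformRows k m) := by
        rw [integral_add Integrable.of_finite Integrable.of_finite]
        simp
    _ ≤ _ := by gcongr

/-! ### Leverage scores and asymptotic normality -/

lemma norm_sq_row_le_maxLeverage {n : ℕ} (U : Matrix (Fin n) (Fin d) ℝ) (i : Fin n) :
    ‖(WithLp.toLp 2 (U i) : EuclideanSpace ℝ (Fin d))‖ ^ 2 ≤ maxLeverage U :=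
  le_ciSup (f := fun i => ‖(WithLp.toLp 2 (U i) : EuclideanSpace ℝ (Fin d))‖ ^ 2)
    (Set.finite_range _).bddAbove i

lemma maxLeverage_nonneg {n : ℕ} (U : Matrix (Fin n) (Fin d) ℝ) : 0 ≤ maxLeverage U :=
  Real.iSup_nonneg fun _ => sq_nonneg _

lemma norm_sq_zeroPad_row_le_maxLeverage {n : ℕ} (U : Matrix (Fin n) (Fin d) ℝ) (i : Fin m) :
    ‖(WithLp.toLp 2 (zeroPad m U i) : EuclideanSpace ℝ (Fin d))‖ ^ 2 ≤ maxLeverage U := by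
  by_cases h : (i : ℕ) < n
  · convert norm_sq_row_le_maxLeverage U ⟨i, h⟩ using 5
    ext l
    simp [zeroPad, h]
  · have h0 : zeroPad m U i = 0 := by
      ext l
      simp [zeroPad, h]
    simpa [h0] using maxLeverage_nonneg U

/-- The Clarkson–Woodruff sketch of singular vectors with vanishing leverage scores is
asymptotically Gaussian. -/
lemma tendsto_clarksonWoodruff_real (hd : 1 ≤ d) (hk : 1 ≤ k) (ε : ℝ) {N : ℕ → ℕ}
    {U : ∀ j, Matrix (Fin (N j)) (Fin d) ℝ} (hU : ∀ j, (U j).transpose * U j = 1)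
    (hlev : Tendsto (fun j => maxLeverage (U j)) atTop (𝓝 0)) :
    Tendsto (fun j => (clarksonWoodruffSketch k (N j)).real
        {S | toRows (S * U j) ∈ nearIsometrySet k d ε}) atTop
      (𝓝 ((gaussianRows k d).real (nearIsometrySet k d ε))) := by
  have : Nonempty (Fin k) := ⟨⟨0, hk⟩⟩
  have hprob : ∀ j, IsProbabilityMeasure
      ((clarksonWoodruffSketch k (N j)).map fun S => toRows (S * U j)) := fun j =>
    isProbabilityMeasure_map_toRows _ _ _
  have h := tendsto_real_nearIsometrySet hd hk ε
    (μ := fun j => (clarksonWoodruffSketch k (N j)).map fun S => toRows (S * U j)) fun t => by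
      simp_rw [clarksonWoodruff_charFun hk]
      rw [← Complex.ofReal_neg, ← Complex.ofReal_exp]
      refine (Complex.continuous_ofReal.tendsto _).comp ?_
      rw [tendsto_iff_norm_sub_tendsto_zero]
      refine squeeze_zero (fun _ => norm_nonneg _) (fun j =>
        abs_clarksonWoodruff_prod_sub_exp_le hk (hU j) (maxLeverage_nonneg (U j))
          (norm_sq_row_le_maxLeverage (U j)) t) ?_
      simpa using hlev.mul_const (‖t‖ ^ 4)
  refine h.congr fun j => ?_
  exact map_measureReal_apply (continuous_toRows_mul _).measurable
    (isClosed_nearIsometrySet ε).measurableSet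

/-- The Hadamard sketch of singular vectors with vanishing leverage scores is asymptotically
Gaussian. -/
lemma tendsto_hadamard_real (hd : 1 ≤ d) (hk : 1 ≤ k) (ε : ℝ) {M : ℕ → ℕ}
    (hM : ∀ j, 0 < M j) {H : ∀ j, Matrix (Fin (M j)) (Fin (M j)) ℝ} (hH : ∀ j, (H j).IsHadamard)
    {U : ∀ j, Matrix (Fin (M j)) (Fin d) ℝ} (hU : ∀ j, (U j).transpose * U j = 1)
    {L : ℕ → ℝ} (hL0 : ∀ j, 0 ≤ L j)
    (hL : ∀ j i, ‖(WithLp.toLp 2 (U j i) : EuclideanSpace ℝ (Fin d))‖ ^ 2 ≤ L j)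
    (hlev : Tendsto L atTop (𝓝 0)) :
    Tendsto (fun j => (hadamardSketch k (H j)).real
        {S | toRows (S * U j) ∈ nearIsometrySet k d ε}) atTop
      (𝓝 ((gaussianRows k d).real (nearIsometrySet k d ε))) := by
  have hne : ∀ j, Nonempty (Fin (M j)) := fun j => ⟨⟨0, hM j⟩⟩
  have hprob : ∀ j, IsProbabilityMeasure
      ((hadamardSketch k (H j)).map fun S => toRows (S * U j)) := fun j => by
    rw [hadamardSketch_eq]
    exact isProbabilityMeasure_map_toRows (uniformRows k (M j))
      (fun r => (√(k : ℝ))⁻¹ • (rowSelection r * H j)) (U j)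
  have h := tendsto_real_nearIsometrySet hd hk ε
    (μ := fun j => (hadamardSketch k (H j)).map fun S => toRows (S * U j)) fun t => by
      have hchar := fun j => charFun_map_toRows_mul_diagonal (uniformRows k (M j))
        (fun r => (√(k : ℝ))⁻¹ • (rowSelection r * H j)) (U j) t
      simp_rw [hadamardSketch_eq, hchar]
      rw [← Complex.ofReal_neg, ← Complex.ofReal_exp]
      refine (Complex.continuous_ofReal.tendsto _).comp ?_
      rw [tendsto_iff_norm_sub_tendsto_zero]
      refine squeeze_zero (fun _ => norm_nonneg _) (fun j =>
        abs_hadamard_integral_sub_exp_le hk (hH j) (hU j) (hL0 j) (hL j) t) ?_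
      have hsqrt : Tendsto (fun j => √(L j)) atTop (𝓝 0) := by
        simpa using hlev.sqrt
      simpa using ((hlev.mul_const (d : ℝ)).mul_const (‖t‖ ^ 4)).add
        ((hsqrt.mul_const (‖t‖ ^ 2)).const_mul (k : ℝ))
  refine h.congr fun j => ?_
  exact map_measureReal_apply (continuous_toRows_mul _).measurable
    (isClosed_nearIsometrySet ε).measurableSet

end Sketching

theorem theorem3 (d k : ℕ) (hd : 1 ≤ d) (hk : 1 ≤ k) (ε : ℝ)
    (N : ℕ → ℕ) (hN : Tendsto N atTop atTop)
    (A : ∀ j, Matrix (Fin (N j)) (Fin d) ℝ) (hA : ∀ j, (A j).rank = d)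
    (U : ∀ j, Matrix (Fin (N j)) (Fin d) ℝ) (s : ∀ _ : ℕ, Fin d → ℝ)
    (V : ∀ _ : ℕ, Matrix (Fin d) (Fin d) ℝ)
    (hsvd : ∀ j, Sketching.IsSVD (A j) (U j) (s j) (V j))
    (hlev : Tendsto (fun j => Sketching.maxLeverage (U j)) atTop (𝓝 0)) :
    (∀ (M : ℕ → ℕ) (_ : ∀ j, N j ≤ M j) (H : ∀ j, Matrix (Fin (M j)) (Fin (M j)) ℝ)
        (_ : ∀ j, (H j).IsHadamard),
      Tendsto (fun j => (Sketching.hadamardSketch k (H j)).real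
          {S | Sketching.IsSubspaceEmbedding ε S (Sketching.zeroPad (M j) (A j))}) atTop
        (𝓝 ((Sketching.wishart k ((1 / (k : ℝ)) • (1 : Matrix (Fin d) (Fin d) ℝ))).real
          {W | Sketching.sigmaMax (1 - W) ≤ ε}))) ∧
    Tendsto (fun j => (Sketching.clarksonWoodruffSketch k (N j)).real
        {S | Sketching.IsSubspaceEmbedding ε S (A j)}) atTop
      (𝓝 ((Sketching.wishart k ((1 / (k : ℝ)) • (1 : Matrix (Fin d) (Fin d) ℝ))).real
        {W | Sketching.sigmaMax (1 - W) ≤ ε})) ∧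
    (∀ j, (Sketching.gaussianSketch k (N j)).real {S | Sketching.IsSubspaceEmbedding ε S (A j)} =
      (Sketching.wishart k ((1 / (k : ℝ)) • (1 : Matrix (Fin d) (Fin d) ℝ))).real
        {W | Sketching.sigmaMax (1 - W) ≤ ε}) := by
  have hU : ∀ j, (U j).transpose * U j = 1 := fun j => (hsvd j).left_orthonormal
  have hC : ∀ j, IsUnit (Matrix.diagonal (s j) * (V j).transpose) := fun j =>
    Sketching.isUnit_diagonal_mul_transpose_of_isSVD (hsvd j) (hA j)
  have hAU : ∀ j, A j = U j * (Matrix.diagonal (s j) * (V j).transpose) := fun j => by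
    rw [← Matrix.mul_assoc]
    exact (hsvd j).eq_mul
  have hset : ∀ j, {S : Matrix (Fin k) (Fin (N j)) ℝ | Sketching.IsSubspaceEmbedding ε S (A j)} =
      {S | Sketching.toRows (S * U j) ∈ Sketching.nearIsometrySet k d ε} := fun j => by
    ext S
    conv_lhs => rw [hAU j]
    exact Sketching.isSubspaceEmbedding_mul_iff (hU j) (hC j) ε S
  rw [Sketching.wishart_real_eq_gaussianRows_real hd]
  refine ⟨fun M hNM H hH => ?_, ?_, fun j => ?_⟩
  · have hpad : ∀ j, {S : Matrix (Fin k) (Fin (M j)) ℝ |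
        Sketching.IsSubspaceEmbedding ε S (Sketching.zeroPad (M j) (A j))} =
        {S | Sketching.toRows (S * Sketching.zeroPad (M j) (U j)) ∈
          Sketching.nearIsometrySet k d ε} := fun j => by
      ext S
      conv_lhs => rw [hAU j, Sketching.zeroPad_mul]
      exact Sketching.isSubspaceEmbedding_mul_iff
        (Sketching.zeroPad_transpose_mul_self (hNM j) (hU j)) (hC j) ε S
    have hM : ∀ j, 0 < M j := fun j => by
      have h1 := (A j).rank_le_height
      have h2 := hA j
      have h3 := hNM j
      omega
    simp_rw [hpad]
    exact Sketching.tendsto_hadamard_real hd hk ε hM hH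
      (fun j => Sketching.zeroPad_transpose_mul_self (hNM j) (hU j))
      (fun j => Sketching.maxLeverage_nonneg (U j))
      (fun j i => Sketching.norm_sq_zeroPad_row_le_maxLeverage (U j) i) hlev
  · simp_rw [hset]
    exact Sketching.tendsto_clarksonWoodruff_real hd hk ε hU hlev
  · rw [hset, ← Sketching.gaussianSketch_map_toRows_mul (hU j)]
    exact (map_measureReal_apply (Sketching.continuous_toRows_mul _).measurable
      (Sketching.isClosed_nearIsometrySet ε).measurableSet).symm
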